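/- Let $(\Omega,\mathcal F)$ be a measurable space carrying a sequence of real random variables $X_1,X_2,\dots$, and let $S_n:=\sum_{i=1}^n X_i$. Let $\mathcal P$ be a family of probability measures on $(\Omega,\mathcal F)$ under each of which $(X_n)_{n\ge 1}$ is a sequence of i.i.d. integrable random variables with expected value zero. Let $(\mathcal F_n)_{n\ge 0}$ be a filtration to which $(X_n)_{n\ge1}$ is adapted (for instance, the one generated by $(X_n)_{n\ge 1}$). For $q\ge 1$, $x\ge 0$ and $P\in\mathcal P$ put $$U_P^{(q)}(x):=\mathsf E_P\big[|X_1|^q\,\mathbf 1\{|X_1|^q\ge x\}\big]\in[0,\infty],$$ and for $A\subseteq\Omega$ let $$\nu_{\mathcal P}[A]:=\inf_{\tau:\,A\subseteq\{\tau<\infty\}}\ \sup_{P\in\mathcal P}P[\tau<\infty]$$ be the inverse capital outer measure of $A$, where the infimum is over all $(\mathcal F_n)$-stopping times $\tau$ with values in $\{0,1,2,\dots\}\cup\{\infty\}$ such that $A\subseteq\{\tau<\infty\}$ (and a supremum over an empty family is $0$). (1) Let $q\in[1,2)$. If $\sup_{P\in\mathcal P}U_P^{(q)}(x)\to0$ as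 $x\to\infty$, then $\nu_{\mathcal P}[A_{q\text{-div}}]=0$, where $$A_{q\text{-div}}:=\Big\{\tfrac{S_n}{n^{1/q}}\text{ does not converge to }0\text{ as }n\to\infty\Big\}.$$ (2) If $\sup_{P\in\mathcal P}U_P^{(2)}(x)\to0$ as $x\to\infty$, then there is $\bar\sigma\in(0,\infty)$ with $\sup_{P\in\mathcal P}\mathrm{Var}_P[X_1]\le\bar\sigma^2$, and for every such $\bar\sigma$ one has $\nu_{\mathcal P}[A_{\mathrm{fluc}}]=0$, where $$A_{\mathrm{fluc}}:=\bigcup_{\varepsilon>0}\ \bigcap_{m\ge 3}\ \bigcup_{k\ge m}\Big\{\frac{|S_k/\bar\sigma|}{\sqrt{2k\log\log k}}\ge 1+\varepsilon\Big\}.$$ -/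

import Mathlib

open MeasureTheory ProbabilityTheory Filter Topology
open scoped ENNReal

/-- The partial sum `S_n = X_1 + ⋯ + X_n`. The sequence is indexed from `0` in the code:
`X i` is the random variable usually written `X_{i+1}`. -/
def partialSum {Ω : Type*} (X : ℕ → Ω → ℝ) (n : ℕ) (ω : Ω) : ℝ :=
  ∑ i ∈ Finset.range n, X i ω

/-- The family of all probability measures under which `X` is a sequence of i.i.d. integrable
random variables with expected value zero. -/
def iidCenteredMeasures {Ω : Type*} [MeasurableSpace Ω] (X : ℕ → Ω → ℝ) : Set (Measure Ω) :=
  {P | IsProbabilityMeasure P ∧ iIndepFun X P ∧ (∀ n, IdentDistrib (X n) (X 0) P P) ∧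
    Integrable (X 0) P ∧ ∫ ω, X 0 ω ∂P = 0}

/-- The truncated absolute moment `E_P[|X_1|^q 1{|X_1|^q ≥ x}]`, with values in `[0, ∞]`. -/
noncomputable def truncatedMoment {Ω : Type*} [MeasurableSpace Ω] (X : ℕ → Ω → ℝ) (q : ℝ)
    (P : Measure Ω) (x : ℝ) : ℝ≥0∞ :=
  ∫⁻ ω in {ω | x ≤ |X 0 ω| ^ q}, ENNReal.ofReal (|X 0 ω| ^ q) ∂P

/-- The inverse capital outer measure of `A`: the infimum, over all stopping times `τ` with
`A ⊆ {τ < ∞}`, of `sup_{P ∈ 𝒬} P[τ < ∞]`. -/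
noncomputable def inverseCapital {Ω : Type*} {mΩ : MeasurableSpace Ω} (ℱ : Filtration ℕ mΩ)
    (𝒬 : Set (Measure Ω)) (A : Set Ω) : ℝ≥0∞ :=
  ⨅ (τ : Ω → WithTop ℕ) (_ : IsStoppingTime ℱ τ) (_ : A ⊆ {ω | τ ω < ⊤}),
    ⨆ P ∈ 𝒬, P {ω | τ ω < ⊤}

/-- The event that `S_n / n^{1/q}` does not converge to `0`. -/
def divEvent {Ω : Type*} (X : ℕ → Ω → ℝ) (q : ℝ) : Set Ω :=
  {ω | ¬ Tendsto (fun n : ℕ => partialSum X n ω / (n : ℝ) ^ (1 / q)) atTop (𝓝 0)}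

/-- The event of super-iterated-logarithm fluctuations at scale `σ`: for some `ε > 0`,
`|S_k / σ| / √(2 k log log k) ≥ 1 + ε` for infinitely many `k`. -/
def flucEvent {Ω : Type*} (X : ℕ → Ω → ℝ) (σ : ℝ) : Set Ω :=
  ⋃ (ε : ℝ) (_ : 0 < ε), ⋂ (m : ℕ) (_ : 1 ≤ m), ⋃ (k : ℕ) (_ : m ≤ k),
    {ω | 1 + ε ≤ |partialSum X k ω / σ| / √(2 * (k : ℝ) * Real.log (Real.log (k : ℝ)))}

/-! Inverse capital zero follows from uniform tail bounds. If each point of `A` lies, for some `j`,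
in infinitely many adapted events `E j k`, and for every `j` the probability that some `E j k` with
`k ≥ m` occurs tends to zero as `m → ∞`, uniformly over the family, then stopping when `E j k`
occurs for some `j` with `k ≥ m j` covers `A` at arbitrarily small uniform cost
(`inverseCapital_eq_zero`). With `j` indexing the tolerance `1 / (j + 1)`, both claims become
distribution-uniform forms of classical limit theorems.

Both are proved on geometric blocks by truncating, recentering and applying a maximal inequality
(`exists_truncation`). Uniformity comes from bounding each block by the integral of an explicit
function of `X 0` (in the second case plus a deterministic summable term). The sum over blocks is
then bounded pointwise in the value of `X 0`, by geometric series, by a multiple of the truncated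
moment's integrand, up to a small constant in the first case. The integrated bound is uniform in
`P`.

For `q < 2` the blocks are dyadic, truncation is at `|x|^q < R` on a block of length `R`, and
Kolmogorov's inequality with a union bound for exceedances suffices
(`exists_measure_tail_partialSum_rpow_le`). For the iterated logarithm the ratio `s` is close to
`1`, truncation is at `b_j`, a small multiple of `√(s^j / log j)`, and a Bernstein bound gives the
summable term `j^{-(1+e)}` (`exists_measure_tail_iterated_log_le`). A union bound for exceedances
would cost `s^j P(|X| ≥ b_j)`, a factor `log j` beyond what the second moment controls. Markov's
inequality for the sum of the discarded parts costs only a multiple of `b_j E[|X|; |X| ≥ b_j]`,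
which does sum to a truncated second moment. -/

/-! ### Stopping times and sets of inverse capital zero. -/

section StoppingTimes

variable {Ω : Type*} {mΩ : MeasurableSpace Ω}

/-- The first entrance time into a sequence of adapted events is a stopping time. -/
theorem exists_isStoppingTime_lt_top_iff (ℱ : Filtration ℕ mΩ) (G : ℕ → Set Ω)
    (hG : ∀ k, MeasurableSet[ℱ k] (G k)) :
    ∃ τ : Ω → WithTop ℕ, IsStoppingTime ℱ τ ∧ {ω | τ ω < ⊤} = ⋃ k, G k := by
  classical
  refine ⟨fun ω => if h : ∃ k, ω ∈ G k then ((Nat.find h : ℕ) : WithTop ℕ) else ⊤, ?_, ?_⟩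
  · intro i
    have : {ω | (if h : ∃ k, ω ∈ G k then ((Nat.find h : ℕ) : WithTop ℕ) else ⊤) ≤ (i : WithTop ℕ)}
        = ⋃ k ∈ Set.Iic i, G k := by
      ext ω
      simp only [Set.mem_ofPred_eq, Set.mem_iUnion, Set.mem_Iic, exists_prop]
      split_ifs with h
      · exact_mod_cast Nat.find_le_iff h i
      · push Not at h
        simp [h]
    have hmeas : MeasurableSet[ℱ i] (⋃ k ∈ Set.Iic i, G k) :=
      MeasurableSet.biUnion (Set.to_countable _) fun k hk => ℱ.mono hk _ (hG k)
    rw [← this] at hmeas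
    exact hmeas
  · ext ω
    simp only [Set.mem_ofPred_eq, Set.mem_iUnion]
    split_ifs with h
    · simp [h]
    · simp [h]

/-- If every point of `A` lies, for some `j`, in infinitely many of the adapted events `E j k`, and
the tail unions of the `E j k` are uniformly small, then `A` has inverse capital zero. -/
theorem inverseCapital_eq_zero (ℱ : Filtration ℕ mΩ) (𝒬 : Set (Measure Ω)) (A : Set Ω)
    (E : ℕ → ℕ → Set Ω) (hE : ∀ j k, MeasurableSet[ℱ k] (E j k))
    (hA : ∀ ω ∈ A, ∃ j, ∀ m, ∃ k, m ≤ k ∧ ω ∈ E j k)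
    (hsmall : ∀ j, ∀ δ : ℝ≥0∞, 0 < δ → ∃ m, ∀ P ∈ 𝒬, P {ω | ∃ k, m ≤ k ∧ ω ∈ E j k} ≤ δ) :
    inverseCapital ℱ 𝒬 A = 0 := by
  refine le_antisymm (le_of_forall_pos_le_add fun δ hδ => ?_) zero_le
  rw [zero_add]
  obtain ⟨δ', hδ', hsum⟩ := ENNReal.exists_pos_sum_of_countable' hδ.ne' ℕ
  choose m hm using fun j => hsmall j (δ' j) (hδ' j)
  -- A single stopping time serves all `j`: the `j`-th family is watched only from time `m j` on and
  -- spends the share `δ' j` of the budget.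
  let G : ℕ → Set Ω := fun k => ⋃ j, ⋃ (_ : m j ≤ k), E j k
  obtain ⟨τ, hτ, hτG⟩ := exists_isStoppingTime_lt_top_iff ℱ G
    fun k => MeasurableSet.iUnion fun j => MeasurableSet.iUnion fun _ => hE j k
  refine iInf_le_of_le τ (iInf_le_of_le hτ (iInf_le_of_le ?_ (iSup₂_le fun P hP => ?_)))
  · rw [hτG]
    intro ω hω
    obtain ⟨j, hj⟩ := hA ω hω
    obtain ⟨k, hk, hkE⟩ := hj (m j)
    simp only [G, Set.mem_iUnion]
    exact ⟨k, j, hk, hkE⟩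
  · have hsub : {ω | τ ω < ⊤} ⊆ ⋃ j, {ω | ∃ k, m j ≤ k ∧ ω ∈ E j k} := by
      rw [hτG]
      intro ω hω
      simp only [G, Set.mem_iUnion] at hω
      obtain ⟨k, j, hk, hkE⟩ := hω
      exact Set.mem_iUnion.2 ⟨j, k, hk, hkE⟩
    calc P {ω | τ ω < ⊤} ≤ ∑' j, P {ω | ∃ k, m j ≤ k ∧ ω ∈ E j k} :=
          (measure_mono hsub).trans (measure_iUnion_le _)
      _ ≤ ∑' j, δ' j := ENNReal.tsum_le_tsum fun j => hm j P hP
      _ ≤ δ := hsum.le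

end StoppingTimes

/-! ### Maximal inequalities for sums of independent centered variables. -/

section MaximalInequalities

variable {Ω : Type*} {mΩ : MeasurableSpace Ω} {P : Measure Ω} {Y : ℕ → Ω → ℝ}

/-- The natural filtration at time `k` already knows `Y k`, hence the `k + 1` summands. -/
theorem ProbabilityTheory.iIndepFun.martingale_sum_range_succ (hY : ∀ i, StronglyMeasurable (Y i))
    (hind : iIndepFun Y P) (hint : ∀ i, Integrable (Y i) P) (hzero : ∀ i, P[Y i] = 0) :
    Martingale (fun k ω => ∑ i ∈ Finset.range (k + 1), Y i ω) (Filtration.natural Y hY) P := by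
  have : IsProbabilityMeasure P := hind.isProbabilityMeasure
  refine martingale_of_condExp_sub_eq_zero_nat (fun k => ?_)
    (fun k => integrable_finsetSum _ fun i _ => hint i) fun k => ?_
  · refine Finset.stronglyMeasurable_fun_sum _ fun i hi => ?_
    exact (Filtration.stronglyAdapted_natural hY i).mono
      ((Filtration.natural Y hY).mono (Nat.lt_succ_iff.1 (Finset.mem_range.1 hi)))
  · have h : (fun ω => ∑ i ∈ Finset.range (k + 1 + 1), Y i ω) -
        (fun ω => ∑ i ∈ Finset.range (k + 1), Y i ω) = Y (k + 1) := by
      ext ω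
      simp [Finset.sum_range_succ _ (k + 1)]
    simp only [h]
    filter_upwards [hind.condExp_natural_ae_eq_of_lt hY (Nat.lt_succ_self k)] with ω hω
    rw [hω, hzero]
    rfl

/-- Doob's maximal inequality for a convex function of the partial sums of independent centered
random variables. -/
theorem ProbabilityTheory.iIndepFun.maximal_ineq_convexOn (hY : ∀ i, Measurable (Y i))
    (hind : iIndepFun Y P) (hint : ∀ i, Integrable (Y i) P) (hzero : ∀ i, P[Y i] = 0)
    {φ : ℝ → ℝ} (hφ : ConvexOn ℝ Set.univ φ) (hφ0 : ∀ x, 0 ≤ φ x)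
    (hφint : ∀ n, Integrable (fun ω => φ (∑ i ∈ Finset.range n, Y i ω)) P) {c : ℝ} (hc : 0 < c)
    (n : ℕ) :
    P {ω | ∃ k ≤ n, 1 ≤ k ∧ c ≤ φ (∑ i ∈ Finset.range k, Y i ω)} ≤
      ENNReal.ofReal ((∫ ω, φ (∑ i ∈ Finset.range n, Y i ω) ∂P) / c) := by
  have : IsProbabilityMeasure P := hind.isProbabilityMeasure
  -- The martingale starts at the one-term sum, so the empty sum is excluded and `n = 0` is
  -- separate.
  rcases n with _ | n
  · have : {ω | ∃ k ≤ 0, 1 ≤ k ∧ c ≤ φ (∑ i ∈ Finset.range k, Y i ω)} = ∅ := by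
      ext ω
      simp only [Set.mem_ofPred_eq, Set.mem_empty_iff_false, iff_false]
      rintro ⟨k, h1, h2, -⟩
      omega
    rw [this]
    simp
  have hYs : ∀ i, StronglyMeasurable (Y i) := fun i => (hY i).stronglyMeasurable
  have hmart := hind.martingale_sum_range_succ hYs hint hzero
  have hcont : Continuous φ := continuousOn_univ.1 (hφ.continuousOn isOpen_univ)
  have hsub : Submartingale (fun k ω => φ (∑ i ∈ Finset.range (k + 1), Y i ω))
      (Filtration.natural Y hYs) P := by
    refine submartingale_nat (fun k => hcont.comp_stronglyMeasurable (hmart.1 k))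
      (fun k => hφint _) fun k => ?_
    -- Conditional Jensen turns the martingale into a submartingale.
    have h1 := hφ.map_condExp_le_of_finiteDimensional ((Filtration.natural Y hYs).le k)
      (hmart.integrable (k + 1)) (hφint (k + 1 + 1))
    have h2 := hmart.condExp_ae_eq (Nat.le_succ k)
    filter_upwards [h1, h2] with ω h1 h2
    simp only [Function.comp_apply] at h1
    rw [h2] at h1
    exact h1
  have hmax := maximal_ineq hsub (fun k ω => hφ0 _) (ε := c.toNNReal) n
  have hset : {ω | ∃ k ≤ n + 1, 1 ≤ k ∧ c ≤ φ (∑ i ∈ Finset.range k, Y i ω)} ⊆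
      {ω | (c.toNNReal : ℝ) ≤ (Finset.range (n + 1)).sup' Finset.nonempty_range_add_one
        fun k => φ (∑ i ∈ Finset.range (k + 1), Y i ω)} := by
    rintro ω ⟨k, hk, hk1, hck⟩
    simp only [Set.mem_ofPred_eq, Real.coe_toNNReal _ hc.le, Finset.le_sup'_iff]
    obtain ⟨k, rfl⟩ := Nat.exists_eq_add_of_le' hk1
    exact ⟨k, Finset.mem_range.2 (by omega), hck⟩
  rw [ENNReal.ofReal_div_of_pos hc, ENNReal.le_div_iff_mul_le (by simp [hc]) (by simp), mul_comm]
  calc ENNReal.ofReal c * _ ≤ ENNReal.ofReal c * P _ := by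
        gcongr
    _ ≤ _ := hmax
    _ ≤ _ := ENNReal.ofReal_le_ofReal
        (setIntegral_le_integral (hφint _) (ae_of_all _ fun ω => hφ0 _))

/-- Comparing power series termwise replaces `u` by `|u|`. For `v ≥ 0` the claim says that `e^{-v}(1
+ v) + v²/2` is at least `1`, its value at `0`, and this function is nondecreasing. -/
theorem Real.exp_le_one_add_add_sq_mul_exp_abs (u : ℝ) :
    Real.exp u ≤ 1 + u + u ^ 2 / 2 * Real.exp |u| := by
  have key : ∀ v : ℝ, 0 ≤ v → Real.exp v - 1 - v ≤ v ^ 2 / 2 * Real.exp v := by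
    intro v hv
    have hmono : MonotoneOn (fun v : ℝ => Real.exp (-v) * (1 + v) + v ^ 2 / 2) (Set.Ici 0) := by
      have hd : ∀ v : ℝ, HasDerivAt (fun v : ℝ => Real.exp (-v) * (1 + v) + v ^ 2 / 2)
          (v - v * Real.exp (-v)) v := by
        intro v
        have h1 : HasDerivAt (fun v : ℝ => Real.exp (-v)) (Real.exp (-v) * (-1)) v :=
          (hasDerivAt_neg v).exp
        have h2 : HasDerivAt (fun v : ℝ => 1 + v) 1 v := (hasDerivAt_id v).const_add 1
        have h3 : HasDerivAt (fun v : ℝ => v ^ 2 / 2) (2 * v / 2) v := by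
          simpa using (hasDerivAt_pow 2 v).div_const 2
        refine ((h1.mul h2).add h3).congr_deriv ?_
        ring
      refine monotoneOn_of_deriv_nonneg (convex_Ici 0)
        (fun v _ => (hd v).continuousAt.continuousWithinAt)
        (fun v _ => (hd v).differentiableAt.differentiableWithinAt) fun v hv => ?_
      rw [interior_Ici, Set.mem_Ioi] at hv
      rw [(hd v).deriv]
      have : Real.exp (-v) ≤ 1 := Real.exp_le_one_iff.2 (by linarith)
      nlinarith
    have h0 := hmono (Set.mem_Ici.2 le_rfl) (Set.mem_Ici.2 hv) hv
    simp only [neg_zero, Real.exp_zero, add_zero, mul_one] at h0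
    have he := Real.exp_pos v
    have hee : Real.exp (-v) * Real.exp v = 1 := by rw [← Real.exp_add]; simp
    nlinarith
  have h := Complex.norm_exp_sub_sum_le_exp_norm_sub_sum (u : ℂ) 2
  have h' : |Real.exp u - (1 + u)| ≤ Real.exp |u| - (1 + |u|) := by
    have e1 : Complex.exp (u : ℂ) - ∑ m ∈ Finset.range 2, (u : ℂ) ^ m / (m.factorial : ℂ) =
        ((Real.exp u - (1 + u) : ℝ) : ℂ) := by
      simp [Finset.sum_range_succ]
    rw [e1, Complex.norm_real, Complex.norm_real] at h
    simpa [Finset.sum_range_succ] using h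
  have := key |u| (abs_nonneg u)
  rw [sq_abs] at this
  have := (le_abs_self _).trans h'
  linarith

/-- The quadratic bound on the exponential is integrated, centering kills the linear term, and `1 +
x ≤ e^x` finishes. The factor `exp (lam * M)` is the loss against the Gaussian case; the truncation
level is later tuned to make it `1 + e`. -/
theorem ProbabilityTheory.mgf_le_exp_of_abs_le [IsProbabilityMeasure P] {Z : Ω → ℝ}
    (hZ : Measurable Z) {M v lam : ℝ} (hM : ∀ ω, |Z ω| ≤ M) (hzero : P[Z] = 0)
    (hv : ∫ ω, Z ω ^ 2 ∂P ≤ v) (hlam : 0 ≤ lam) :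
    mgf Z P lam ≤ Real.exp (lam ^ 2 * v / 2 * Real.exp (lam * M)) := by
  have hint : Integrable Z P :=
    Integrable.of_bound hZ.aestronglyMeasurable M (ae_of_all _ fun ω => by simpa using hM ω)
  have hint2 : Integrable (fun ω => Z ω ^ 2) P :=
    Integrable.of_bound (hZ.pow_const 2).aestronglyMeasurable (M ^ 2) (ae_of_all _ fun ω => by
      rw [Real.norm_eq_abs, abs_pow]
      exact pow_le_pow_left₀ (abs_nonneg _) (hM ω) 2)
  have hpt : ∀ ω, Real.exp (lam * Z ω) ≤
      1 + lam * Z ω + lam ^ 2 / 2 * Real.exp (lam * M) * Z ω ^ 2 := by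
    intro ω
    have h1 := Real.exp_le_one_add_add_sq_mul_exp_abs (lam * Z ω)
    have h2 : Real.exp |lam * Z ω| ≤ Real.exp (lam * M) := by
      rw [abs_mul, abs_of_nonneg hlam]
      exact Real.exp_le_exp.2 (mul_le_mul_of_nonneg_left (hM ω) hlam)
    have h3 : (lam * Z ω) ^ 2 / 2 * Real.exp |lam * Z ω| ≤
        (lam * Z ω) ^ 2 / 2 * Real.exp (lam * M) := by gcongr
    nlinarith
  have hi1 : Integrable (fun ω => 1 + lam * Z ω) P := (integrable_const _).add (hint.const_mul _)
  have hi2 : Integrable (fun ω => lam ^ 2 / 2 * Real.exp (lam * M) * Z ω ^ 2) P :=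
    hint2.const_mul _
  calc mgf Z P lam ≤ ∫ ω, (1 + lam * Z ω + lam ^ 2 / 2 * Real.exp (lam * M) * Z ω ^ 2) ∂P :=
        integral_mono_of_nonneg (ae_of_all _ fun ω => (Real.exp_pos _).le) (hi1.add hi2)
          (ae_of_all _ hpt)
    _ = 1 + lam ^ 2 / 2 * Real.exp (lam * M) * ∫ ω, Z ω ^ 2 ∂P := by
        rw [integral_add hi1 hi2, integral_add (integrable_const _) (hint.const_mul _),
          integral_const_mul, integral_const_mul, hzero]
        simp
    _ ≤ 1 + lam ^ 2 * v / 2 * Real.exp (lam * M) := by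
        have : lam ^ 2 / 2 * Real.exp (lam * M) * ∫ ω, Z ω ^ 2 ∂P ≤
          lam ^ 2 / 2 * Real.exp (lam * M) * v := by gcongr
        linarith
    _ ≤ _ := by
        rw [add_comm]
        exact Real.add_one_le_exp _

/-- **Kolmogorov's maximal inequality** for bounded independent centered random variables. -/
theorem ProbabilityTheory.iIndepFun.kolmogorov_maximal_ineq (hY : ∀ i, Measurable (Y i))
    (hind : iIndepFun Y P) {M v t : ℝ} (hM : ∀ i ω, |Y i ω| ≤ M) (hzero : ∀ i, P[Y i] = 0)
    (hv : ∀ i, ∫ ω, Y i ω ^ 2 ∂P ≤ v) (ht : 0 < t) (n : ℕ) :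
    P {ω | ∃ k ≤ n, t ≤ |∑ i ∈ Finset.range k, Y i ω|} ≤ ENNReal.ofReal (n * v / t ^ 2) := by
  have : IsProbabilityMeasure P := hind.isProbabilityMeasure
  have hmem : ∀ i, MemLp (Y i) 2 P := fun i =>
    MemLp.of_bound (hY i).aestronglyMeasurable M (ae_of_all _ fun ω => by simpa using hM i ω)
  have hmems : ∀ n, MemLp (fun ω => ∑ i ∈ Finset.range n, Y i ω) 2 P := fun n =>
    memLp_finsetSum _ fun i _ => hmem i
  have h := hind.maximal_ineq_convexOn hY (fun i => (hmem i).integrable (by norm_num)) hzero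
    (φ := fun x => x ^ 2) (Even.convexOn_pow (by decide)) (fun x => sq_nonneg x)
    (fun n => (hmems n).integrable_sq) (c := t ^ 2) (by positivity) n
  have hset : {ω | ∃ k ≤ n, t ≤ |∑ i ∈ Finset.range k, Y i ω|} ⊆
      {ω | ∃ k ≤ n, 1 ≤ k ∧ t ^ 2 ≤ (∑ i ∈ Finset.range k, Y i ω) ^ 2} := by
    rintro ω ⟨k, hk, hkt⟩
    refine ⟨k, hk, ?_, ?_⟩
    · rcases k with _ | k
      · simp at hkt
        linarith
      · omega
    · rw [← sq_abs (∑ i ∈ Finset.range k, Y i ω)]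
      exact pow_le_pow_left₀ ht.le hkt 2
  refine (measure_mono hset).trans (h.trans (ENNReal.ofReal_le_ofReal ?_))
  gcongr
  have hvar : ∫ ω, (∑ i ∈ Finset.range n, Y i ω) ^ 2 ∂P =
      ∑ i ∈ Finset.range n, ∫ ω, Y i ω ^ 2 ∂P := by
    have h1 := IndepFun.variance_sum (μ := P) (s := Finset.range n) (X := Y) (fun i _ => hmem i)
      (fun i _ j _ hij => hind.indepFun hij)
    have h2 : ∀ i, variance (Y i) P = ∫ ω, Y i ω ^ 2 ∂P := fun i =>
      variance_of_integral_eq_zero (hY i).aemeasurable (hzero i)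
    have h3 : variance (∑ i ∈ Finset.range n, Y i) P =
        ∫ ω, (∑ i ∈ Finset.range n, Y i ω) ^ 2 ∂P := by
      rw [variance_of_integral_eq_zero]
      · simp
      · exact Finset.aemeasurable_sum _ fun i _ => (hY i).aemeasurable
      · simp only [Finset.sum_apply]
        rw [integral_finsetSum _ fun i _ => (hmem i).integrable (by norm_num)]
        simp [hzero]
    rw [← h3, h1]
    exact Finset.sum_congr rfl fun i _ => h2 i
  rw [hvar]
  calc _ ≤ ∑ i ∈ Finset.range n, v := Finset.sum_le_sum fun i _ => hv i
    _ = n * v := by simp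

/-- One-sided maximal inequality of Bernstein type. -/
theorem ProbabilityTheory.iIndepFun.exp_maximal_ineq (hY : ∀ i, Measurable (Y i))
    (hind : iIndepFun Y P) {M v t lam : ℝ} (hM : ∀ i ω, |Y i ω| ≤ M) (hzero : ∀ i, P[Y i] = 0)
    (hv : ∀ i, ∫ ω, Y i ω ^ 2 ∂P ≤ v) (ht : 0 < t) (hlam : 0 ≤ lam) (n : ℕ) :
    P {ω | ∃ k ≤ n, t ≤ ∑ i ∈ Finset.range k, Y i ω} ≤
      ENNReal.ofReal (Real.exp (-(lam * t) + n * (lam ^ 2 * v / 2 * Real.exp (lam * M)))) := by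
  have : IsProbabilityMeasure P := hind.isProbabilityMeasure
  have hint : ∀ i, Integrable (Y i) P := fun i =>
    Integrable.of_bound (hY i).aestronglyMeasurable M (ae_of_all _ fun ω => by simpa using hM i ω)
  have hφ : ConvexOn ℝ Set.univ fun x : ℝ => Real.exp (lam * x) := by
    have := convexOn_exp.comp_linearMap (LinearMap.mulLeft ℝ lam)
    simpa [Function.comp_def] using this
  have hφint : ∀ n, Integrable (fun ω => Real.exp (lam * ∑ i ∈ Finset.range n, Y i ω)) P := by
    intro n
    have hm : Measurable fun ω => ∑ i ∈ Finset.range n, Y i ω :=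
      Finset.measurable_fun_sum _ fun i _ => hY i
    refine Integrable.of_bound (hm.const_mul lam).exp.aestronglyMeasurable
      (Real.exp (lam * (n * M))) (ae_of_all _ fun ω => ?_)
    rw [Real.norm_eq_abs, Real.abs_exp]
    refine Real.exp_le_exp.2 (mul_le_mul_of_nonneg_left ?_ hlam)
    calc ∑ i ∈ Finset.range n, Y i ω ≤ ∑ i ∈ Finset.range n, M :=
          Finset.sum_le_sum fun i _ => (le_abs_self _).trans (hM i ω)
      _ = n * M := by simp
  have h := hind.maximal_ineq_convexOn hY hint hzero hφ (fun x => (Real.exp_pos _).le) hφint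
    (Real.exp_pos (lam * t)) n
  have hset : {ω | ∃ k ≤ n, t ≤ ∑ i ∈ Finset.range k, Y i ω} ⊆
      {ω | ∃ k ≤ n, 1 ≤ k ∧
        Real.exp (lam * t) ≤ Real.exp (lam * ∑ i ∈ Finset.range k, Y i ω)} := by
    rintro ω ⟨k, hk, hkt⟩
    refine ⟨k, hk, ?_, Real.exp_le_exp.2 (mul_le_mul_of_nonneg_left hkt hlam)⟩
    rcases k with _ | k
    · simp at hkt
      linarith
    · omega
  refine (measure_mono hset).trans (h.trans (ENNReal.ofReal_le_ofReal ?_))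
  have hmgf := hind.mgf_sum (t := lam) hY (Finset.range n)
  have hmgf' : ∫ ω, Real.exp (lam * ∑ i ∈ Finset.range n, Y i ω) ∂P =
      ∏ i ∈ Finset.range n, mgf (Y i) P lam := by
    rw [← hmgf]
    simp [mgf]
  rw [hmgf', Real.exp_add, Real.exp_neg, div_eq_inv_mul]
  gcongr
  calc ∏ i ∈ Finset.range n, mgf (Y i) P lam
      ≤ ∏ i ∈ Finset.range n, Real.exp (lam ^ 2 * v / 2 * Real.exp (lam * M)) :=
        Finset.prod_le_prod (fun i _ => mgf_nonneg) fun i _ =>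
          mgf_le_exp_of_abs_le (hY i) (hM i) (hzero i) (hv i) hlam
    _ = _ := by simp [Real.exp_nat_mul]

/-- Two-sided maximal inequality of Bernstein type. -/
theorem ProbabilityTheory.iIndepFun.exp_maximal_ineq_abs (hY : ∀ i, Measurable (Y i))
    (hind : iIndepFun Y P) {M v t lam : ℝ} (hM : ∀ i ω, |Y i ω| ≤ M) (hzero : ∀ i, P[Y i] = 0)
    (hv : ∀ i, ∫ ω, Y i ω ^ 2 ∂P ≤ v) (ht : 0 < t) (hlam : 0 ≤ lam) (n : ℕ) :
    P {ω | ∃ k ≤ n, t ≤ |∑ i ∈ Finset.range k, Y i ω|} ≤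
      2 * ENNReal.ofReal (Real.exp (-(lam * t) + n * (lam ^ 2 * v / 2 * Real.exp (lam * M)))) := by
  have h1 := hind.exp_maximal_ineq hY hM hzero hv ht hlam n
  have hind' : iIndepFun (fun i ω => -Y i ω) P :=
    hind.comp (fun _ x => -x) fun _ => measurable_neg
  have h2 := hind'.exp_maximal_ineq (fun i => (hY i).neg) (M := M) (v := v)
    (fun i ω => by simpa using hM i ω) (fun i => by simp [integral_neg, hzero])
    (fun i => by simpa using hv i) ht hlam n
  rw [two_mul]
  refine (measure_mono ?_).trans ((measure_union_le _ _).trans (add_le_add h1 h2))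
  rintro ω ⟨k, hk, hkt⟩
  rcases le_abs.1 hkt with h | h
  · exact Or.inl ⟨k, hk, h⟩
  · exact Or.inr ⟨k, hk, by simpa using h⟩

end MaximalInequalities

/-! ### Truncated geometric sums. -/

section GeometricSums

/-- Under geometric growth a full sum is at most `κ / (κ - 1)` times its last term. Terms above `y`
at the end are stripped off until the last one is at most `y`. -/
theorem sum_range_ite_le_of_growth {b : ℕ → ℝ} {κ : ℝ} (hκ : 1 < κ) (hb : ∀ j, 0 ≤ b j)
    (hgrow : ∀ j, κ * b j ≤ b (j + 1)) {y : ℝ} (hy : 0 ≤ y) (N : ℕ) :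
    ∑ j ∈ Finset.range N, (if b j ≤ y then b j else 0) ≤ κ / (κ - 1) * y := by
  have hκ' : 0 < κ - 1 := by linarith
  have htot : ∀ N, ∑ j ∈ Finset.range (N + 1), b j ≤ κ / (κ - 1) * b N := by
    intro N
    rw [div_mul_eq_mul_div, le_div_iff₀ hκ']
    induction N with
    | zero => simpa using by nlinarith [hb 0]
    | succ N ih =>
      rw [Finset.sum_range_succ]
      nlinarith [hgrow N]
  have hC : 0 ≤ κ / (κ - 1) := by positivity
  induction N with
  | zero => simpa using by positivity
  | succ N ih =>
    by_cases h : b N ≤ y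
    · calc _ ≤ ∑ j ∈ Finset.range (N + 1), b j :=
            Finset.sum_le_sum fun j _ => by split_ifs <;> simp [hb j]
        _ ≤ κ / (κ - 1) * b N := htot N
        _ ≤ _ := mul_le_mul_of_nonneg_left h hC
    · rw [Finset.sum_range_succ, if_neg h, add_zero]
      exact ih

/-- Mirror image of the growing case: initial terms above `z` are shifted away, and from then on the
first term controls the sum by telescoping. -/
theorem sum_range_ite_le_of_decay {d : ℕ → ℝ} {θ : ℝ} (hθ : θ < 1) (hd : ∀ j, 0 ≤ d j)
    (hdec : ∀ j, d (j + 1) ≤ θ * d j) {z : ℝ} (hz : 0 ≤ z) (N : ℕ) :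
    ∑ j ∈ Finset.range N, (if d j ≤ z then d j else 0) ≤ z / (1 - θ) := by
  have hθ' : 0 < 1 - θ := by linarith
  have htot : ∀ (N : ℕ), (1 - θ) * ∑ j ∈ Finset.range N, d j ≤ d 0 - d N := by
    intro N
    induction N with
    | zero => simp
    | succ N ih =>
      rw [Finset.sum_range_succ]
      nlinarith [hdec N]
  induction N generalizing d with
  | zero => simpa using by positivity
  | succ N ih =>
    by_cases h : d 0 ≤ z
    · calc _ ≤ ∑ j ∈ Finset.range (N + 1), d j :=
            Finset.sum_le_sum fun j _ => by split_ifs <;> simp [hd j]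
        _ ≤ z / (1 - θ) := by
            rw [le_div_iff₀ hθ', mul_comm]
            linarith [htot (N + 1), hd (N + 1)]
    · rw [Finset.sum_range_succ', if_neg h, add_zero]
      -- The telescoping bound is part of the generalized induction statement, so it is re-proved
      -- for the shifted sequence.
      refine ih (d := fun j => d (j + 1)) (fun j => hd _) (fun j => hdec _) fun M => ?_
      induction M with
      | zero => simp
      | succ M ihM =>
        rw [Finset.sum_range_succ]
        nlinarith [hdec (M + 1)]

end GeometricSums

/-! ### Truncation and block maximal inequalities. -/

section Truncation

variable {Ω : Type*} {mΩ : MeasurableSpace Ω} {P : Measure Ω} {X : ℕ → Ω → ℝ}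

/-- Truncation of an i.i.d. centered sequence to a bounded set `B`, followed by recentering. -/
theorem exists_truncation (hX : ∀ i, Measurable (X i)) (hP : P ∈ iidCenteredMeasures X)
    {B : Set ℝ} (hB : MeasurableSet B) {b : ℝ} (hb : 0 ≤ b) (hBb : ∀ x ∈ B, |x| ≤ b) :
    ∃ Y : ℕ → Ω → ℝ, (∀ i, Measurable (Y i)) ∧ iIndepFun Y P ∧ (∀ i ω, |Y i ω| ≤ 2 * b) ∧
      (∀ i, P[Y i] = 0) ∧ (∀ i, ∫ ω, Y i ω ^ 2 ∂P ≤ ∫ ω, B.indicator id (X 0 ω) ^ 2 ∂P) ∧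
      ∀ r t : ℝ, 0 ≤ t →
        ENNReal.ofReal r * ∫⁻ ω, ‖Bᶜ.indicator id (X 0 ω)‖ₑ ∂P ≤ ENNReal.ofReal t →
        ∀ k : ℕ, (k : ℝ) ≤ r → ∀ ω, |partialSum X k ω| ≤ |∑ i ∈ Finset.range k, Y i ω| +
          ∑ i ∈ Finset.range k, |Bᶜ.indicator id (X i ω)| + t := by
  obtain ⟨hprob, hind, hid, hint, hmean⟩ := hP
  have hf : Measurable (B.indicator (id : ℝ → ℝ)) := measurable_id.indicator hB
  have hg : Measurable (Bᶜ.indicator (id : ℝ → ℝ)) := measurable_id.indicator hB.compl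
  have hfb : ∀ x, |B.indicator (id : ℝ → ℝ) x| ≤ b := by
    intro x
    by_cases h : x ∈ B
    · simpa [h] using hBb x h
    · simpa [h] using hb
  have hfX : ∀ i, Measurable fun ω => B.indicator (id : ℝ → ℝ) (X i ω) := fun i => hf.comp (hX i)
  have hfmem : MemLp (fun ω => B.indicator (id : ℝ → ℝ) (X 0 ω)) 2 P :=
    MemLp.of_bound (hfX 0).aestronglyMeasurable b (ae_of_all _ fun ω => by simpa using hfb _)
  set m : ℝ := ∫ ω, B.indicator (id : ℝ → ℝ) (X 0 ω) ∂P with hm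
  have hmb : |m| ≤ b := by
    have := norm_integral_le_of_norm_le_const (μ := P) (C := b)
      (f := fun ω => B.indicator (id : ℝ → ℝ) (X 0 ω)) (ae_of_all _ fun ω => by simpa using hfb _)
    simpa using this
  have hYm : Measurable fun x : ℝ => B.indicator (id : ℝ → ℝ) x - m := hf.sub_const m
  have hsplit : ∀ x : ℝ, B.indicator (id : ℝ → ℝ) x + Bᶜ.indicator (id : ℝ → ℝ) x = x := by
    intro x
    exact Set.indicator_self_add_compl_apply B id x
  have hidY : ∀ i, IdentDistrib (fun ω => B.indicator (id : ℝ → ℝ) (X i ω) - m)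
      (fun ω => B.indicator (id : ℝ → ℝ) (X 0 ω) - m) P P := fun i => (hid i).comp hYm
  refine ⟨fun i ω => B.indicator id (X i ω) - m, fun i => (hfX i).sub_const m,
    hind.comp (fun _ x => B.indicator id x - m) fun _ => hYm, ?_, ?_, ?_, ?_⟩
  · intro i ω
    have h1 := hfb (X i ω)
    have h2 := abs_sub (B.indicator id (X i ω)) m
    linarith
  · intro i
    rw [(hidY i).integral_eq, integral_sub (hfmem.integrable (by norm_num)) (integrable_const _)]
    simp [hm]
  · intro i
    have h := ((hidY i).comp (measurable_id.pow_const 2)).integral_eq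
    simp only [Function.comp_def, id] at h
    rw [h, ← variance_eq_integral (hfX 0).aemeasurable]
    exact variance_le_expectation_sq (hfX 0).aestronglyMeasurable
  · intro r t ht hrt k hk ω
    -- As `X 0` is centered, the truncated mean is minus the mean of the discarded part, so the
    -- first moment beyond `B` bounds the drift `k * m`.
    have hmg : ‖m‖ₑ ≤ ∫⁻ ω, ‖Bᶜ.indicator (id : ℝ → ℝ) (X 0 ω)‖ₑ ∂P := by
      have hgint : Integrable (fun ω => Bᶜ.indicator (id : ℝ → ℝ) (X 0 ω)) P := by
        have h := hint.sub (hfmem.integrable (by norm_num))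
        refine h.congr (ae_of_all _ fun ω => ?_)
        simp only [Pi.sub_apply]
        linarith [hsplit (X 0 ω)]
      have h0 : m = -∫ ω, Bᶜ.indicator (id : ℝ → ℝ) (X 0 ω) ∂P := by
        have h := integral_add (hfmem.integrable (by norm_num)) hgint
        simp only [hsplit, hmean] at h
        linarith
      rw [h0, enorm_neg]
      exact enorm_integral_le_lintegral_enorm _
    have hr : 0 ≤ r := (Nat.cast_nonneg k).trans hk
    have hrm : r * |m| ≤ t := by
      have h1 : ENNReal.ofReal (r * |m|) ≤ ENNReal.ofReal t := by
        rw [ENNReal.ofReal_mul hr, ← Real.norm_eq_abs, ofReal_norm]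
        exact (mul_le_mul_right hmg _).trans hrt
      exact (ENNReal.ofReal_le_ofReal_iff ht).1 h1
    have hkm : |(k : ℝ) * m| ≤ t := by
      rw [abs_mul, Nat.abs_cast]
      exact (mul_le_mul_of_nonneg_right hk (abs_nonneg _)).trans hrm
    have hsum : partialSum X k ω = ∑ i ∈ Finset.range k, (B.indicator id (X i ω) - m) +
        ∑ i ∈ Finset.range k, Bᶜ.indicator id (X i ω) + k * m := by
      rw [partialSum, Finset.sum_sub_distrib, Finset.sum_const, Finset.card_range, nsmul_eq_mul,
        sub_add_eq_add_sub, sub_add_cancel, ← Finset.sum_add_distrib]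
      exact Finset.sum_congr rfl fun i _ => (hsplit _).symm
    rw [hsum]
    refine (abs_add_le _ _).trans (add_le_add ((abs_add_le _ _).trans ?_) hkm)
    gcongr
    exact Finset.abs_sum_le_sum_abs _ _

/-- Maximal inequality combining Kolmogorov's inequality for the truncated variables with a union
bound for the exceedances. -/
theorem measure_exists_partialSum_ge_le (hX : ∀ i, Measurable (X i))
    (hP : P ∈ iidCenteredMeasures X) {B : Set ℝ} (hB : MeasurableSet B) {b : ℝ} (hb : 0 ≤ b)
    (hBb : ∀ x ∈ B, |x| ≤ b) {r t : ℝ} (ht : 0 < t)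
    (hrt : ENNReal.ofReal r * ∫⁻ ω, ‖Bᶜ.indicator id (X 0 ω)‖ₑ ∂P ≤ ENNReal.ofReal t) :
    P {ω | ∃ k : ℕ, (k : ℝ) ≤ r ∧ 2 * t ≤ |partialSum X k ω|} ≤
      ENNReal.ofReal (r / t ^ 2) * ∫⁻ ω, ENNReal.ofReal (B.indicator id (X 0 ω) ^ 2) ∂P +
        ENNReal.ofReal r * P {ω | X 0 ω ∉ B} := by
  obtain ⟨Y, hYm, hYind, hYb, hY0, hYv, hYsum⟩ := exists_truncation hX hP hB hb hBb
  obtain ⟨hprob, hind, hid, hint, hmean⟩ := hP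
  rcases lt_or_ge r 0 with hr | hr
  · have : {ω | ∃ k : ℕ, (k : ℝ) ≤ r ∧ 2 * t ≤ |partialSum X k ω|} = ∅ := by
      ext ω
      simp only [Set.mem_ofPred_eq, Set.mem_empty_iff_false, iff_false]
      rintro ⟨k, hk, -⟩
      linarith [(Nat.cast_nonneg k : (0 : ℝ) ≤ k)]
    rw [this]
    simp
  have hnr : (⌊r⌋₊ : ℝ) ≤ r := Nat.floor_le hr
  have hK := hYind.kolmogorov_maximal_ineq hYm hYb hY0 hYv ht ⌊r⌋₊
  have hset : {ω | ∃ k : ℕ, (k : ℝ) ≤ r ∧ 2 * t ≤ |partialSum X k ω|} ⊆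
      {ω | ∃ k ≤ ⌊r⌋₊, t ≤ |∑ i ∈ Finset.range k, Y i ω|} ∪
        ⋃ i ∈ Finset.range ⌊r⌋₊, {ω | X i ω ∉ B} := by
    rintro ω ⟨k, hk, hkt⟩
    have hk' : k ≤ ⌊r⌋₊ := Nat.le_floor hk
    -- With no exceedance the remainder sum vanishes: one `t` pays for the drift, the other is left
    -- for Kolmogorov's inequality.
    by_cases h : ∀ i ∈ Finset.range k, X i ω ∈ B
    · refine Or.inl ⟨k, hk', ?_⟩
      have h1 := hYsum r t ht.le hrt k hk ω
      have h2 : ∑ i ∈ Finset.range k, |Bᶜ.indicator id (X i ω)| = 0 :=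
        Finset.sum_eq_zero fun i hi => by simp [h i hi]
      linarith
    · push Not at h
      obtain ⟨i, hi, hiB⟩ := h
      exact Or.inr (Set.mem_biUnion (x := i) (Finset.range_mono hk' hi) hiB)
  have hfm : Measurable fun ω => B.indicator (id : ℝ → ℝ) (X 0 ω) :=
    (measurable_id.indicator hB).comp (hX 0)
  refine (measure_mono hset).trans ((measure_union_le _ _).trans (add_le_add ?_ ?_))
  · refine hK.trans ?_
    rw [← ofReal_integral_eq_lintegral_ofReal, ← ENNReal.ofReal_mul (by positivity)]
    · refine ENNReal.ofReal_le_ofReal ?_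
      rw [div_mul_eq_mul_div]
      gcongr
    · refine Integrable.of_bound (hfm.pow_const 2).aestronglyMeasurable (b ^ 2)
        (ae_of_all _ fun ω => ?_)
      rw [Real.norm_eq_abs, abs_pow]
      refine pow_le_pow_left₀ (abs_nonneg _) ?_ 2
      by_cases h : X 0 ω ∈ B
      · simpa [h] using hBb _ h
      · simpa [h] using hb
    · exact ae_of_all _ fun ω => sq_nonneg _
  · refine (measure_biUnion_finset_le _ _).trans ?_
    have : ∀ i, P {ω | X i ω ∉ B} = P {ω | X 0 ω ∉ B} := fun i =>
      (hid i).measure_mem_eq hB.compl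
    simp only [this, Finset.sum_const, Finset.card_range, nsmul_eq_mul]
    gcongr
    rw [← ENNReal.ofReal_natCast]
    exact ENNReal.ofReal_le_ofReal hnr

/-- Maximal inequality combining Bernstein's inequality for the truncated variables with Markov's
inequality for the remainders. -/
theorem measure_exists_partialSum_ge_le_exp (hX : ∀ i, Measurable (X i))
    (hP : P ∈ iidCenteredMeasures X) {B : Set ℝ} (hB : MeasurableSet B) {b : ℝ} (hb : 0 ≤ b)
    (hBb : ∀ x ∈ B, |x| ≤ b) {v : ℝ} (hv : ∫⁻ ω, ENNReal.ofReal (X 0 ω ^ 2) ∂P ≤ ENNReal.ofReal v)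
    (hv0 : 0 ≤ v) {lam r t₁ t₂ t₃ : ℝ} (hlam : 0 ≤ lam) (ht₁ : 0 < t₁) (ht₂ : 0 < t₂) (ht₃ : 0 ≤ t₃)
    (hrt : ENNReal.ofReal r * ∫⁻ ω, ‖Bᶜ.indicator id (X 0 ω)‖ₑ ∂P ≤ ENNReal.ofReal t₃) :
    P {ω | ∃ k : ℕ, (k : ℝ) ≤ r ∧ t₁ + t₂ + t₃ ≤ |partialSum X k ω|} ≤
      2 * ENNReal.ofReal
          (Real.exp (-(lam * t₁) + r * (lam ^ 2 * v / 2 * Real.exp (lam * (2 * b))))) +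
        ENNReal.ofReal (r / t₂) * ∫⁻ ω, ‖Bᶜ.indicator id (X 0 ω)‖ₑ ∂P := by
  obtain ⟨Y, hYm, hYind, hYb, hY0, hYv, hYsum⟩ := exists_truncation hX hP hB hb hBb
  obtain ⟨hprob, hind, hid, hint, hmean⟩ := hP
  rcases lt_or_ge r 0 with hr | hr
  · have : {ω | ∃ k : ℕ, (k : ℝ) ≤ r ∧ t₁ + t₂ + t₃ ≤ |partialSum X k ω|} = ∅ := by
      ext ω
      simp only [Set.mem_ofPred_eq, Set.mem_empty_iff_false, iff_false]
      rintro ⟨k, hk, -⟩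
      linarith [(Nat.cast_nonneg k : (0 : ℝ) ≤ k)]
    rw [this]
    simp
  have hnr : (⌊r⌋₊ : ℝ) ≤ r := Nat.floor_le hr
  have hfm : Measurable fun ω => B.indicator (id : ℝ → ℝ) (X 0 ω) :=
    (measurable_id.indicator hB).comp (hX 0)
  have hYv' : ∀ i, ∫ ω, Y i ω ^ 2 ∂P ≤ v := by
    intro i
    refine (hYv i).trans ?_
    rw [integral_eq_lintegral_of_nonneg_ae (ae_of_all _ fun ω => sq_nonneg _)
      (hfm.pow_const 2).aestronglyMeasurable]
    refine ENNReal.toReal_le_of_le_ofReal hv0 (le_trans (lintegral_mono fun ω => ?_) hv)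
    refine ENNReal.ofReal_le_ofReal ?_
    by_cases h : X 0 ω ∈ B
    · simp [h]
    · simpa [h] using sq_nonneg (X 0 ω)
  have hK := hYind.exp_maximal_ineq_abs hYm hYb hY0 hYv' ht₁ hlam ⌊r⌋₊
  have hset : {ω | ∃ k : ℕ, (k : ℝ) ≤ r ∧ t₁ + t₂ + t₃ ≤ |partialSum X k ω|} ⊆
      {ω | ∃ k ≤ ⌊r⌋₊, t₁ ≤ |∑ i ∈ Finset.range k, Y i ω|} ∪
        {ω | ENNReal.ofReal t₂ ≤ ∑ i ∈ Finset.range ⌊r⌋₊, ‖Bᶜ.indicator id (X i ω)‖ₑ} := by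
    rintro ω ⟨k, hk, hkt⟩
    have hk' : k ≤ ⌊r⌋₊ := Nat.le_floor hk
    by_cases h : t₁ ≤ |∑ i ∈ Finset.range k, Y i ω|
    · exact Or.inl ⟨k, hk', h⟩
    · refine Or.inr ?_
      have h1 := hYsum r t₃ ht₃ hrt k hk ω
      have h2 : t₂ ≤ ∑ i ∈ Finset.range k, |Bᶜ.indicator id (X i ω)| := by linarith
      have h3 : ∑ i ∈ Finset.range k, |Bᶜ.indicator id (X i ω)| ≤
          ∑ i ∈ Finset.range ⌊r⌋₊, |Bᶜ.indicator id (X i ω)| :=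
        Finset.sum_le_sum_of_subset_of_nonneg (Finset.range_mono hk') fun i _ _ => abs_nonneg _
      have h4 := ENNReal.ofReal_le_ofReal (h2.trans h3)
      rw [ENNReal.ofReal_sum_of_nonneg fun i _ => abs_nonneg _] at h4
      simpa only [Set.mem_ofPred_eq, Real.enorm_eq_ofReal_abs] using h4
  have hgm : Measurable fun x : ℝ => ‖Bᶜ.indicator (id : ℝ → ℝ) x‖ₑ :=
    (measurable_id.indicator hB.compl).enorm
  refine (measure_mono hset).trans ((measure_union_le _ _).trans (add_le_add ?_ ?_))
  · refine hK.trans ?_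
    gcongr
  · have hmar := meas_ge_le_lintegral_div (μ := P)
      (f := fun ω => ∑ i ∈ Finset.range ⌊r⌋₊, ‖Bᶜ.indicator id (X i ω)‖ₑ)
      (Finset.aemeasurable_fun_sum _ fun i _ => (hgm.comp (hX i)).aemeasurable)
      (ε := ENNReal.ofReal t₂) (by simp [ht₂]) (by simp)
    refine hmar.trans ?_
    rw [lintegral_finsetSum (Finset.range ⌊r⌋₊)
      (f := fun i ω => ‖Bᶜ.indicator id (X i ω)‖ₑ) fun i _ => hgm.comp (hX i)]
    have : ∀ i, ∫⁻ ω, ‖Bᶜ.indicator id (X i ω)‖ₑ ∂P = ∫⁻ ω, ‖Bᶜ.indicator id (X 0 ω)‖ₑ ∂P :=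
      fun i => ((hid i).comp hgm).lintegral_eq
    simp only [this, Finset.sum_const, Finset.card_range, nsmul_eq_mul]
    rw [ENNReal.ofReal_div_of_pos ht₂, ENNReal.mul_div_right_comm]
    gcongr
    rw [← ENNReal.ofReal_natCast]
    exact ENNReal.ofReal_le_ofReal hnr

end Truncation

/-! ### Truncated moments. -/

section TruncatedMoments

variable {Ω : Type*} {mΩ : MeasurableSpace Ω} {P : Measure Ω} {X : ℕ → Ω → ℝ}

theorem measurableSet_abs_rpow_lt (q c : ℝ) : MeasurableSet {x : ℝ | |x| ^ q < c} :=
  measurableSet_lt (by fun_prop) measurable_const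

theorem abs_le_rpow_inv_of_abs_rpow_lt {q c x : ℝ} (hq : 0 < q) (h : |x| ^ q < c) :
    |x| ≤ c ^ (1 / q) := by
  calc |x| = (|x| ^ q) ^ (1 / q) := by
        rw [← Real.rpow_mul (abs_nonneg x), mul_one_div_cancel hq.ne', Real.rpow_one]
    _ ≤ c ^ (1 / q) := Real.rpow_le_rpow (by positivity) h.le (by positivity)

theorem truncatedMoment_antitone (q : ℝ) (P : Measure Ω) : Antitone (truncatedMoment X q P) :=
  fun _ _ hxy => lintegral_mono_set fun _ hω => hxy.trans hω

theorem truncatedMoment_eq_lintegral (hX : ∀ i, Measurable (X i)) (q c : ℝ) :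
    truncatedMoment X q P c =
      ∫⁻ ω, ENNReal.ofReal (if c ≤ |X 0 ω| ^ q then |X 0 ω| ^ q else 0) ∂P := by
  have hm : MeasurableSet {ω | c ≤ |X 0 ω| ^ q} :=
    measurableSet_le measurable_const (by have := hX 0; fun_prop)
  rw [truncatedMoment, ← lintegral_indicator hm]
  refine lintegral_congr fun ω => ?_
  by_cases h : c ≤ |X 0 ω| ^ q <;> simp [h]

/-- The first absolute moment above a truncation level is controlled by the truncated `q`-th
moment. -/
theorem lintegral_enorm_compl_indicator_le (hX : ∀ i, Measurable (X i)) {q c : ℝ} (hq : 1 ≤ q)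
    (hc : 0 < c) :
    ∫⁻ ω, ‖{x : ℝ | |x| ^ q < c}ᶜ.indicator id (X 0 ω)‖ₑ ∂P ≤
      ENNReal.ofReal (c ^ (1 / q - 1)) * truncatedMoment X q P c := by
  rw [truncatedMoment_eq_lintegral hX, ← lintegral_const_mul' _ _ ENNReal.ofReal_ne_top]
  refine lintegral_mono fun ω => ?_
  rw [← ENNReal.ofReal_mul (by positivity), Real.enorm_eq_ofReal_abs]
  refine ENNReal.ofReal_le_ofReal ?_
  by_cases h : c ≤ |X 0 ω| ^ q
  · have hq0 : 0 < q := by linarith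
    have hy : 0 < |X 0 ω| ^ q := hc.trans_le h
    have hmem : X 0 ω ∈ {x : ℝ | |x| ^ q < c}ᶜ := by simpa using h
    rw [Set.indicator_of_mem hmem, if_pos h, id]
    calc |X 0 ω| = (|X 0 ω| ^ q) ^ (1 / q - 1) * |X 0 ω| ^ q := by
          rw [← Real.rpow_add_one hy.ne', sub_add_cancel, ← Real.rpow_mul (abs_nonneg _),
            mul_one_div_cancel hq0.ne', Real.rpow_one]
      _ ≤ c ^ (1 / q - 1) * |X 0 ω| ^ q := by
          gcongr ?_ * _
          refine Real.rpow_le_rpow_of_nonpos hc h ?_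
          rw [sub_nonpos, div_le_one hq0]
          exact hq
  · have hmem : X 0 ω ∉ {x : ℝ | |x| ^ q < c}ᶜ := by simpa using h
    rw [Set.indicator_of_notMem hmem, if_neg h]
    simp

theorem eventually_truncatedMoment_le {𝒬 : Set (Measure Ω)} {q : ℝ}
    (h : Tendsto (fun x : ℝ => ⨆ P ∈ 𝒬, truncatedMoment X q P x) atTop (𝓝 0)) {η : ℝ≥0∞}
    (hη : 0 < η) : ∀ᶠ x in atTop, ∀ P ∈ 𝒬, truncatedMoment X q P x ≤ η := by
  filter_upwards [h.eventually (gt_mem_nhds hη)] with x hx P hP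
  exact (le_iSup₂ (f := fun P (_ : P ∈ 𝒬) => truncatedMoment X q P x) P hP).trans hx.le

end TruncatedMoments

/-! ### The uniform Marcinkiewicz–Zygmund law, `1 ≤ q < 2`. -/

section MarcinkiewiczZygmund

variable {Ω : Type*} {mΩ : MeasurableSpace Ω} {P : Measure Ω} {X : ℕ → Ω → ℝ}

/-- Truncation at `|x|^q < R` makes the drift at most `R * R^(1/q - 1) * ε`, exactly the threshold
`ε * R^(1/q)`. The bound is left as one integral in `X 0` so that it can be summed over `R`
pointwise. -/
theorem measure_exists_partialSum_ge_rpow_le (hX : ∀ i, Measurable (X i))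
    (hP : P ∈ iidCenteredMeasures X) {q R ε : ℝ} (hq : 1 ≤ q) (hR : 0 < R) (hε : 0 < ε)
    (hU : truncatedMoment X q P R ≤ ENNReal.ofReal ε) :
    P {ω | ∃ k : ℕ, (k : ℝ) ≤ R ∧ 2 * (ε * R ^ (1 / q)) ≤ |partialSum X k ω|} ≤
      ∫⁻ ω, ENNReal.ofReal (R ^ (1 - 2 / q) / ε ^ 2 * (if |X 0 ω| ^ q < R then X 0 ω ^ 2 else 0) +
        (if R ≤ |X 0 ω| ^ q then R else 0)) ∂P := by
  have hq0 : 0 < q := by linarith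
  have h0 := hX 0
  have hB := measurableSet_abs_rpow_lt q R
  have h := measure_exists_partialSum_ge_le hX hP hB (b := R ^ (1 / q)) (by positivity)
    (fun x hx => abs_le_rpow_inv_of_abs_rpow_lt hq0 hx) (r := R) (t := ε * R ^ (1 / q))
    (by positivity) ?_
  · refine h.trans (le_of_eq ?_)
    have hm1 : Measurable fun ω => if |X 0 ω| ^ q < R then X 0 ω ^ 2 else 0 :=
      Measurable.ite (measurableSet_lt (by fun_prop) measurable_const) (by fun_prop)
        measurable_const
    have hms : MeasurableSet {ω | R ≤ |X 0 ω| ^ q} :=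
      measurableSet_le measurable_const (by fun_prop)
    have hc : R / (ε * R ^ (1 / q)) ^ 2 = R ^ (1 - 2 / q) / ε ^ 2 := by
      rw [mul_pow, ← Real.rpow_natCast (R ^ (1 / q)), ← Real.rpow_mul hR.le, Real.rpow_sub hR,
        Real.rpow_one, show 1 / q * ((2 : ℕ) : ℝ) = 2 / q by push_cast; ring]
      field_simp
    rw [hc]
    have hsplit : ∀ ω, ENNReal.ofReal (R ^ (1 - 2 / q) / ε ^ 2 *
        (if |X 0 ω| ^ q < R then X 0 ω ^ 2 else 0) + (if R ≤ |X 0 ω| ^ q then R else 0)) =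
        ENNReal.ofReal (R ^ (1 - 2 / q) / ε ^ 2) *
          ENNReal.ofReal (if |X 0 ω| ^ q < R then X 0 ω ^ 2 else 0) +
          ENNReal.ofReal (if R ≤ |X 0 ω| ^ q then R else 0) := by
      intro ω
      rw [ENNReal.ofReal_add, ENNReal.ofReal_mul (by positivity)]
      · refine mul_nonneg (by positivity) ?_
        split_ifs <;> positivity
      · split_ifs <;> positivity
    simp only [hsplit]
    rw [lintegral_add_left (hm1.ennreal_ofReal.const_mul _),
      lintegral_const_mul _ hm1.ennreal_ofReal]
    congr 1
    · congr 1
      refine lintegral_congr fun ω => ?_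
      by_cases hω : |X 0 ω| ^ q < R <;> simp [Set.indicator, hω]
    · have : ∀ ω, ENNReal.ofReal (if R ≤ |X 0 ω| ^ q then R else 0) =
          {ω | R ≤ |X 0 ω| ^ q}.indicator (fun _ => ENNReal.ofReal R) ω := by
        intro ω
        by_cases hω : R ≤ |X 0 ω| ^ q <;> simp [hω]
      simp only [this]
      rw [lintegral_indicator_const hms]
      simp
  · calc _ ≤ ENNReal.ofReal R * (ENNReal.ofReal (R ^ (1 / q - 1)) * ENNReal.ofReal ε) := by
          gcongr
          exact (lintegral_enorm_compl_indicator_le hX hq hR).trans (by gcongr)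
      _ = ENNReal.ofReal (ε * R ^ (1 / q)) := by
          rw [← ENNReal.ofReal_mul (by positivity), ← ENNReal.ofReal_mul (by positivity)]
          congr 1
          rw [Real.rpow_sub_one hR.ne']
          field_simp

/-- Put `y = |x|^q`. Blocks with `2^(J+j) ≤ y` form a growing series of size at most `2y`. The
others form a decaying series, since `1 - 2/q < 0`, of order `y^(1-2/q) * x² = y`. If `y < K ≤ 2^J`,
the first kind is absent and the second leaves a remainder that vanishes as `J → ∞`. -/
theorem sum_range_truncated_le {q : ℝ} (hq : 1 ≤ q) (hq2 : q < 2) {K : ℝ} (hK : 0 < K) {J : ℕ}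
    (hJ : K ≤ 2 ^ J) {ε : ℝ} (x : ℝ) (N : ℕ) :
    ∑ j ∈ Finset.range N,
      (((2 : ℝ) ^ (J + j)) ^ (1 - 2 / q) / ε ^ 2 * (if |x| ^ q < 2 ^ (J + j) then x ^ 2 else 0) +
        (if (2 : ℝ) ^ (J + j) ≤ |x| ^ q then (2 : ℝ) ^ (J + j) else 0)) ≤
    (2 + 1 / ((1 - 2 ^ (1 - 2 / q)) * ε ^ 2)) * (if K ≤ |x| ^ q then |x| ^ q else 0) +
      K ^ (2 / q) / ((1 - 2 ^ (1 - 2 / q)) * ε ^ 2) * (2 ^ (1 - 2 / q)) ^ J := by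
  have hq0 : 0 < q := by linarith
  set θ : ℝ := 2 ^ (1 - 2 / q) with hθ
  have hs : 1 - 2 / q < 0 := by
    rw [sub_neg, one_lt_div hq0]
    exact hq2
  have hθ0 : 0 < θ := by positivity
  have hθ1 : θ < 1 := Real.rpow_lt_one_of_one_lt_of_neg (by norm_num) hs
  have hpow : ∀ j : ℕ, ((2 : ℝ) ^ j) ^ (1 - 2 / q) = θ ^ j := by
    intro j
    rw [hθ, ← Real.rpow_natCast, ← Real.rpow_natCast, ← Real.rpow_mul (by norm_num),
      ← Real.rpow_mul (by norm_num), mul_comm]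
  set y : ℝ := |x| ^ q with hy
  have hy0 : 0 ≤ y := by positivity
  have hx2 : x ^ 2 = y ^ (2 / q) := by
    rw [hy, ← Real.rpow_mul (abs_nonneg x), mul_div_cancel₀ _ hq0.ne', ← sq_abs]
    norm_cast
  rw [Finset.sum_add_distrib]
  have h1 : ∑ j ∈ Finset.range N, (if (2 : ℝ) ^ (J + j) ≤ y then (2 : ℝ) ^ (J + j) else 0) ≤
      2 * (if K ≤ y then y else 0) := by
    split_ifs with hKy
    · have := sum_range_ite_le_of_growth (b := fun j => (2 : ℝ) ^ (J + j)) (κ := 2) (by norm_num)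
        (fun j => by positivity) (fun j => le_of_eq (by ring)) hy0 N
      norm_num at this
      exact this
    · rw [mul_zero]
      refine (Finset.sum_eq_zero fun j _ => if_neg fun h => hKy ?_).le
      refine (hJ.trans ?_).trans h
      exact pow_le_pow_right₀ (by norm_num) (by omega)
  have h2 : ∑ j ∈ Finset.range N, θ ^ (J + j) * (if y < 2 ^ (J + j) then x ^ 2 else 0) ≤
      1 / (1 - θ) * (if K ≤ y then y else 0) + K ^ (2 / q) / (1 - θ) * θ ^ J := by
    have hdec := fun z hz => sum_range_ite_le_of_decay (d := fun j => θ ^ (J + j)) (θ := θ) (z := z)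
      hθ1 (fun j => by positivity) (fun j => le_of_eq (by ring)) hz N
    have h1θ : 0 < 1 - θ := by linarith
    split_ifs with hKy
    · have hypos : 0 < y := hK.trans_le hKy
      have hz := hdec (y ^ (1 - 2 / q)) (by positivity)
      calc _ ≤ ∑ j ∈ Finset.range N,
            x ^ 2 * (if θ ^ (J + j) ≤ y ^ (1 - 2 / q) then θ ^ (J + j) else 0) := by
            refine Finset.sum_le_sum fun j _ => ?_
            by_cases h : y < 2 ^ (J + j)
            · rw [if_pos h, if_pos, mul_comm]
              rw [← hpow]
              exact Real.rpow_le_rpow_of_nonpos hypos h.le hs.le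
            · rw [if_neg h, mul_zero]
              exact mul_nonneg (sq_nonneg _) (by split_ifs <;> positivity)
        _ ≤ x ^ 2 * (y ^ (1 - 2 / q) / (1 - θ)) := by
            rw [← Finset.mul_sum]
            exact mul_le_mul_of_nonneg_left hz (sq_nonneg _)
        _ = 1 / (1 - θ) * y := by
            have : y ^ (2 / q) * y ^ (1 - 2 / q) = y := by
              rw [← Real.rpow_add hypos]
              simp
            rw [hx2, ← mul_div_assoc, this]
            ring
        _ ≤ _ := le_add_of_nonneg_right (by positivity)
    -- With `z = θ ^ J` the cutoff excludes nothing, so this is the whole geometric tail.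
    · have hz := hdec (θ ^ J) (by positivity)
      push Not at hKy
      calc _ ≤ ∑ j ∈ Finset.range N,
            K ^ (2 / q) * (if θ ^ (J + j) ≤ θ ^ J then θ ^ (J + j) else 0) := by
            refine Finset.sum_le_sum fun j _ => ?_
            rw [if_pos (pow_le_pow_of_le_one hθ0.le hθ1.le (by omega)), mul_comm]
            gcongr
            split_ifs
            · rw [hx2]
              exact Real.rpow_le_rpow hy0 hKy.le (by positivity)
            · positivity
        _ ≤ K ^ (2 / q) * (θ ^ J / (1 - θ)) := by
            rw [← Finset.mul_sum]
            gcongr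
        _ = _ := by ring
  have h3 : ∑ j ∈ Finset.range N,
      ((2 : ℝ) ^ (J + j)) ^ (1 - 2 / q) / ε ^ 2 * (if y < 2 ^ (J + j) then x ^ 2 else 0) =
      (∑ j ∈ Finset.range N, θ ^ (J + j) * (if y < 2 ^ (J + j) then x ^ 2 else 0)) / ε ^ 2 := by
    rw [Finset.sum_div]
    refine Finset.sum_congr rfl fun j _ => ?_
    rw [hpow]
    ring
  rw [h3]
  calc _ ≤ (1 / (1 - θ) * (if K ≤ y then y else 0) + K ^ (2 / q) / (1 - θ) * θ ^ J) / ε ^ 2 +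
        2 * (if K ≤ y then y else 0) := by gcongr
    _ = _ := by
        rw [← div_div, ← div_div]
        ring

/-- Sums of nonnegative lintegrals are controlled by a pointwise bound on partial sums. -/
theorem tsum_lintegral_ofReal_le {F : ℕ → Ω → ℝ} {G : Ω → ℝ} (hF : ∀ j, Measurable (F j))
    (hF0 : ∀ j ω, 0 ≤ F j ω) (hFG : ∀ N ω, ∑ j ∈ Finset.range N, F j ω ≤ G ω) :
    ∑' j, ∫⁻ ω, ENNReal.ofReal (F j ω) ∂P ≤ ∫⁻ ω, ENNReal.ofReal (G ω) ∂P := by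
  refine ENNReal.tsum_le_of_sum_range_le fun N => ?_
  rw [← lintegral_finsetSum _ fun j _ => (hF j).ennreal_ofReal]
  refine lintegral_mono fun ω => ?_
  rw [← ENNReal.ofReal_sum_of_nonneg fun j _ => hF0 j ω]
  exact ENNReal.ofReal_le_ofReal (hFG N ω)

/-- Distribution-uniform Marcinkiewicz–Zygmund strong law of large numbers. -/
theorem exists_measure_tail_partialSum_rpow_le (hX : ∀ i, Measurable (X i)) {𝒬 : Set (Measure Ω)}
    (hQ : 𝒬 ⊆ iidCenteredMeasures X) {q : ℝ} (hq : 1 ≤ q) (hq2 : q < 2)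
    (h : Tendsto (fun x : ℝ => ⨆ P ∈ 𝒬, truncatedMoment X q P x) atTop (𝓝 0)) {ε : ℝ} (hε : 0 < ε)
    {δ : ℝ≥0∞} (hδ : 0 < δ) :
    ∃ m : ℕ, ∀ P ∈ 𝒬,
      P {ω | ∃ k, m ≤ k ∧ ε ≤ |partialSum X k ω / (k : ℝ) ^ (1 / q)|} ≤ δ := by
  have hq0 : 0 < q := by linarith
  have h0 := hX 0
  set θ : ℝ := 2 ^ (1 - 2 / q) with hθ
  have hs : 1 - 2 / q < 0 := by
    rw [sub_neg, one_lt_div hq0]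
    exact hq2
  have hθ0 : 0 < θ := by positivity
  have hθ1 : θ < 1 := Real.rpow_lt_one_of_one_lt_of_neg (by norm_num) hs
  have h1θ : 0 < 1 - θ := by linarith
  -- One factor `2` is in the block inequality; the other is the loss `2^(1/q) ≤ 2` from moving to
  -- the right endpoint of a dyadic block.
  set ε' : ℝ := ε / 4 with hε'
  have hε'0 : 0 < ε' := by positivity
  set A : ℝ := 2 + 1 / ((1 - θ) * ε' ^ 2) with hA
  have hA0 : 0 < A := by positivity
  have hδ2 : 0 < δ / 2 := ENNReal.half_pos hδ.ne'
  have hη : 0 < δ / 2 / ENNReal.ofReal A := ENNReal.div_pos hδ2.ne' ENNReal.ofReal_ne_top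
  -- `K` is fixed before `J`: it makes the moment term at most `δ / 2` and validates the drift
  -- condition on every block from `2^J ≥ K` on. `J` then absorbs the remainder, which depends on
  -- `K`.
  obtain ⟨K, ⟨hK1, hK2⟩, hK⟩ := ((eventually_truncatedMoment_le h hη).and
    (eventually_truncatedMoment_le h (ENNReal.ofReal_pos.2 hε'0)) |>.and
      (eventually_gt_atTop 0)).exists
  have hlim : Tendsto (fun J : ℕ => ENNReal.ofReal (K ^ (2 / q) / ((1 - θ) * ε' ^ 2) * θ ^ J)) atTop
      (𝓝 0) := by
    have := (tendsto_pow_atTop_nhds_zero_of_lt_one hθ0.le hθ1).const_mul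
      (K ^ (2 / q) / ((1 - θ) * ε' ^ 2))
    rw [mul_zero] at this
    simpa using ENNReal.tendsto_ofReal this
  obtain ⟨J, hJ1, hJ2⟩ := ((hlim.eventually (gt_mem_nhds hδ2)).and
    ((tendsto_pow_atTop_atTop_of_one_lt (one_lt_two : (1 : ℝ) < 2)).eventually_ge_atTop K)).exists
  refine ⟨2 ^ J, fun P hP => ?_⟩
  have hprob : IsProbabilityMeasure P := (hQ hP).1
  have hset : {ω | ∃ k, 2 ^ J ≤ k ∧ ε ≤ |partialSum X k ω / (k : ℝ) ^ (1 / q)|} ⊆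
      ⋃ j : ℕ, {ω | ∃ k : ℕ, (k : ℝ) ≤ 2 ^ (J + j) ∧
        2 * (ε' * ((2 : ℝ) ^ (J + j)) ^ (1 / q)) ≤ |partialSum X k ω|} := by
    rintro ω ⟨k, hk, hkε⟩
    have hk1 : 1 ≤ k := Nat.one_le_two_pow.trans hk
    obtain ⟨j, hj1, hj2⟩ := exists_nat_pow_near hk1 (one_lt_two : 1 < 2)
    have hJj : J < j + 1 := (Nat.pow_lt_pow_iff_right (one_lt_two : 1 < 2)).1 (hk.trans_lt hj2)
    refine Set.mem_iUnion.2 ⟨j + 1 - J, k, ?_, ?_⟩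
    · rw [Nat.add_sub_cancel' hJj.le]
      exact_mod_cast hj2.le
    · rw [Nat.add_sub_cancel' hJj.le]
      have hk0 : (0 : ℝ) < k := by exact_mod_cast hk1
      have hkp : 0 < (k : ℝ) ^ (1 / q) := by positivity
      rw [abs_div, abs_of_pos hkp, le_div_iff₀ hkp] at hkε
      refine le_trans ?_ hkε
      have h1 : ((2 : ℝ) ^ (j + 1)) ^ (1 / q) ≤ 2 * (k : ℝ) ^ (1 / q) := by
        rw [pow_succ, Real.mul_rpow (by positivity) (by norm_num), mul_comm]
        gcongr
        · calc (2 : ℝ) ^ (1 / q) ≤ 2 ^ (1 : ℝ) :=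
                Real.rpow_le_rpow_of_exponent_le (by norm_num) ((div_le_one hq0).2 hq)
            _ = 2 := Real.rpow_one 2
        · exact_mod_cast hj1
      calc 2 * (ε' * ((2 : ℝ) ^ (j + 1)) ^ (1 / q)) ≤ 2 * (ε' * (2 * (k : ℝ) ^ (1 / q))) := by
            gcongr
        _ = ε * (k : ℝ) ^ (1 / q) := by rw [hε']; ring
  refine (measure_mono hset).trans ((measure_iUnion_le _).trans ?_)
  calc _ ≤ ∑' j : ℕ, ∫⁻ ω, ENNReal.ofReal (((2 : ℝ) ^ (J + j)) ^ (1 - 2 / q) / ε' ^ 2 *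
          (if |X 0 ω| ^ q < 2 ^ (J + j) then X 0 ω ^ 2 else 0) +
          (if (2 : ℝ) ^ (J + j) ≤ |X 0 ω| ^ q then (2 : ℝ) ^ (J + j) else 0)) ∂P := by
        refine ENNReal.tsum_le_tsum fun j =>
          measure_exists_partialSum_ge_rpow_le hX (hQ hP) hq (by positivity) hε'0 ?_
        refine (truncatedMoment_antitone q P (hJ2.trans ?_)).trans (hK2 P hP)
        exact pow_le_pow_right₀ (by norm_num) (by omega)
    _ ≤ ∫⁻ ω, ENNReal.ofReal (A * (if K ≤ |X 0 ω| ^ q then |X 0 ω| ^ q else 0) +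
          K ^ (2 / q) / ((1 - θ) * ε' ^ 2) * θ ^ J) ∂P := by
        refine tsum_lintegral_ofReal_le (fun j => ?_) (fun j ω => ?_)
          fun N ω => sum_range_truncated_le hq hq2 hK hJ2 (X 0 ω) N
        · refine Measurable.add (Measurable.const_mul (Measurable.ite ?_ ?_ ?_) _)
            (Measurable.ite ?_ ?_ ?_)
          · exact measurableSet_lt (by fun_prop) measurable_const
          · fun_prop
          · fun_prop
          · exact measurableSet_le measurable_const (by fun_prop)
          · fun_prop
          · fun_prop
        · refine add_nonneg (mul_nonneg (by positivity) ?_) ?_ <;> split_ifs <;> positivity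
    _ = ENNReal.ofReal A * truncatedMoment X q P K +
          ENNReal.ofReal (K ^ (2 / q) / ((1 - θ) * ε' ^ 2) * θ ^ J) := by
        have hsplit : ∀ ω, ENNReal.ofReal (A * (if K ≤ |X 0 ω| ^ q then |X 0 ω| ^ q else 0) +
            K ^ (2 / q) / ((1 - θ) * ε' ^ 2) * θ ^ J) =
            ENNReal.ofReal A * ENNReal.ofReal (if K ≤ |X 0 ω| ^ q then |X 0 ω| ^ q else 0) +
              ENNReal.ofReal (K ^ (2 / q) / ((1 - θ) * ε' ^ 2) * θ ^ J) := by
          intro ω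
          rw [ENNReal.ofReal_add, ENNReal.ofReal_mul hA0.le]
          · exact mul_nonneg hA0.le (by split_ifs <;> positivity)
          · positivity
        simp only [hsplit]
        rw [lintegral_add_right _ measurable_const, lintegral_const_mul' _ _ ENNReal.ofReal_ne_top,
          truncatedMoment_eq_lintegral hX]
        simp
    _ ≤ δ / 2 + δ / 2 := by
        gcongr
        calc _ ≤ ENNReal.ofReal A * (δ / 2 / ENNReal.ofReal A) := by
              gcongr
              exact hK1 P hP
          _ = δ / 2 := ENNReal.mul_div_cancel (by simp [hA0]) ENNReal.ofReal_ne_top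
    _ = δ := ENNReal.add_halves δ

end MarcinkiewiczZygmund

/-! ### The uniform upper law of the iterated logarithm. -/

section IteratedLogarithm

variable {Ω : Type*} {mΩ : MeasurableSpace Ω} {P : Measure Ω} {X : ℕ → Ω → ℝ}

theorem evariance_eq_lintegral_sq (hP : P ∈ iidCenteredMeasures X) :
    evariance (X 0) P = ∫⁻ ω, ENNReal.ofReal (X 0 ω ^ 2) ∂P := by
  rw [evariance_eq_lintegral_ofReal, hP.2.2.2.2]
  simp

theorem evariance_le_of_truncatedMoment_le (hX : ∀ i, Measurable (X i))
    (hP : P ∈ iidCenteredMeasures X) {K : ℝ} (hK : 0 < K) (hU : truncatedMoment X 2 P K ≤ 1) :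
    evariance (X 0) P ≤ ENNReal.ofReal (K + 1) := by
  have hprob : IsProbabilityMeasure P := hP.1
  rw [evariance_eq_lintegral_sq hP]
  calc ∫⁻ ω, ENNReal.ofReal (X 0 ω ^ 2) ∂P
      ≤ ∫⁻ ω, (ENNReal.ofReal K +
          ENNReal.ofReal (if K ≤ |X 0 ω| ^ (2 : ℝ) then |X 0 ω| ^ (2 : ℝ) else 0)) ∂P := by
        refine lintegral_mono fun ω => ?_
        have hsq : |X 0 ω| ^ (2 : ℝ) = X 0 ω ^ 2 := by
          rw [Real.rpow_two, sq_abs]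
        rw [hsq]
        split_ifs with h
        · exact le_add_self
        · exact (ENNReal.ofReal_le_ofReal (not_le.1 h).le).trans le_self_add
    _ = ENNReal.ofReal K + truncatedMoment X 2 P K := by
        rw [lintegral_add_left measurable_const, truncatedMoment_eq_lintegral hX]
        simp
    _ ≤ ENNReal.ofReal K + 1 := by gcongr
    _ = ENNReal.ofReal (K + 1) := by rw [ENNReal.ofReal_add hK.le zero_le_one, ENNReal.ofReal_one]

/-- Maximal inequality on one geometric block, with time horizon `u ^ 2` and iterated logarithm
`w ^ 2`. -/
theorem measure_exists_partialSum_ge_block_le (hX : ∀ i, Measurable (X i))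
    (hP : P ∈ iidCenteredMeasures X) {σ e u w η : ℝ} (hσ : 0 < σ) (he : 0 < e) (hu : 0 < u)
    (hw : 0 < w) (hv : evariance (X 0) P ≤ ENNReal.ofReal (σ ^ 2))
    (hη : η = σ * Real.log (1 + e) / (2 * √2))
    (hU : truncatedMoment X 2 P ((η * (u / w)) ^ 2) ≤ ENNReal.ofReal (e * σ * √2 * η)) :
    P {ω | ∃ k : ℕ, (k : ℝ) ≤ u ^ 2 ∧ (1 + 3 * e) * (σ * (√2 * u * w)) ≤ |partialSum X k ω|} ≤
      2 * ENNReal.ofReal (Real.exp (-((1 + e) * w ^ 2))) +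
        ∫⁻ ω, ENNReal.ofReal (1 / (e * σ * √2 * η) *
          (if η * (u / w) ≤ |X 0 ω| then η * (u / w) else 0) * |X 0 ω|) ∂P := by
  have hlog : 0 < Real.log (1 + e) := Real.log_pos (by linarith)
  have hη0 : 0 < η := by rw [hη]; positivity
  have h2 : (√2 : ℝ) ^ 2 = 2 := Real.sq_sqrt (by norm_num)
  have hd : 0 < (√2 : ℝ) := by positivity
  set d : ℝ := √2
  set b : ℝ := η * (u / w) with hb
  have hb0 : 0 < b := by positivity
  have hmemB : ∀ x : ℝ, x ∈ {x : ℝ | |x| ^ (2 : ℝ) < b ^ 2} ↔ |x| < b := by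
    intro x
    rw [Set.mem_ofPred_eq, Real.rpow_two]
    exact pow_lt_pow_iff_left₀ (abs_nonneg x) hb0.le (by norm_num)
  have hE : lintegral P (fun ω => ‖{x : ℝ | |x| ^ (2 : ℝ) < b ^ 2}ᶜ.indicator id (X 0 ω)‖ₑ) ≤
      ENNReal.ofReal (1 / b) * ENNReal.ofReal (e * σ * d * η) := by
    refine (lintegral_enorm_compl_indicator_le hX one_le_two (c := b ^ 2) (by positivity)).trans ?_
    have : (b ^ 2) ^ ((1 : ℝ) / 2 - 1) = 1 / b := by
      rw [show (1 : ℝ) / 2 - 1 = -(1 / 2) by norm_num, Real.rpow_neg (by positivity),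
        ← Real.sqrt_eq_rpow, Real.sqrt_sq hb0.le, one_div]
    rw [this]
    gcongr
  -- The factor `1 + 3e` is split as `1 + e` for Bernstein, `e` for Markov and `e` for the drift.
  -- With this `lam`, the value of `η` gives `lam * 2b = log (1 + e)`, so the exponent is `-2(1 +
  -- e)w² + (1 + e)w²`.
  have h := measure_exists_partialSum_ge_le_exp hX hP (measurableSet_abs_rpow_lt 2 (b ^ 2)) hb0.le
    (fun x hx => ((hmemB x).1 hx).le) (v := σ ^ 2) (by rwa [← evariance_eq_lintegral_sq hP])
    (by positivity) (lam := d * w / (u * σ)) (r := u ^ 2) (t₁ := (1 + e) * (σ * (d * u * w)))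
    (t₂ := e * (σ * (d * u * w))) (t₃ := e * (σ * (d * u * w))) (by positivity) (by positivity)
    (by positivity) (by positivity) ?_
  · have ht : (1 + e) * (σ * (d * u * w)) + e * (σ * (d * u * w)) + e * (σ * (d * u * w)) =
        (1 + 3 * e) * (σ * (d * u * w)) := by ring
    rw [ht] at h
    refine h.trans (add_le_add (le_of_eq ?_) ?_)
    · have hexp : Real.exp (d * w / (u * σ) * (2 * b)) = 1 + e := by
        have : d * w / (u * σ) * (2 * b) = Real.log (1 + e) := by
          rw [hb, hη]
          field_simp
        rw [this, Real.exp_log (by linarith)]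
      have harg : -(d * w / (u * σ) * ((1 + e) * (σ * (d * u * w)))) +
          u ^ 2 * ((d * w / (u * σ)) ^ 2 * σ ^ 2 / 2 * (1 + e)) = -((1 + e) * w ^ 2) := by
        have h1 : d * w / (u * σ) * ((1 + e) * (σ * (d * u * w))) = d ^ 2 * ((1 + e) * w ^ 2) := by
          field_simp
        have h3 : u ^ 2 * ((d * w / (u * σ)) ^ 2 * σ ^ 2 / 2 * (1 + e)) =
            d ^ 2 * ((1 + e) * w ^ 2) / 2 := by
          field_simp
        rw [h1, h3, h2]
        ring
      rw [hexp, harg]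
    · rw [← lintegral_const_mul' _ _ ENNReal.ofReal_ne_top]
      refine lintegral_mono fun ω => ?_
      rw [Real.enorm_eq_ofReal_abs, ← ENNReal.ofReal_mul (by positivity)]
      refine ENNReal.ofReal_le_ofReal (le_of_eq ?_)
      by_cases hω : b ≤ |X 0 ω|
      · have hmem : X 0 ω ∈ {x : ℝ | |x| ^ (2 : ℝ) < b ^ 2}ᶜ := by
          rw [Set.mem_compl_iff, hmemB]
          exact not_lt.2 hω
        rw [Set.indicator_of_mem hmem, if_pos hω, id, hb]
        field_simp
      · have hmem : X 0 ω ∉ {x : ℝ | |x| ^ (2 : ℝ) < b ^ 2}ᶜ := by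
          rw [Set.mem_compl_iff, hmemB, not_not]
          exact not_le.1 hω
        rw [Set.indicator_of_notMem hmem, if_neg hω]
        simp
  · calc _ ≤ ENNReal.ofReal (u ^ 2) *
          (ENNReal.ofReal (1 / b) * ENNReal.ofReal (e * σ * d * η)) := by gcongr
      _ = ENNReal.ofReal (e * (σ * (d * u * w))) := by
          rw [← ENNReal.ofReal_mul (by positivity), ← ENNReal.ofReal_mul (by positivity)]
          congr 1
          rw [hb]
          field_simp

/-- A block with `k ≥ s^j` only gives `log k ≥ j log s`. The constant costs a bounded term in the
second logarithm, which any factor `s > 1` eventually absorbs. -/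
theorem eventually_log_le_mul_log_mul {s c : ℝ} (hs : 1 < s) (hc : 0 < c) :
    ∀ᶠ j : ℕ in atTop, Real.log j ≤ s * Real.log (j * c) := by
  have hlog : Tendsto (fun j : ℕ => Real.log j) atTop atTop :=
    Real.tendsto_log_atTop.comp tendsto_natCast_atTop_atTop
  filter_upwards [hlog.eventually_ge_atTop (-(s * Real.log c) / (s - 1)), eventually_gt_atTop 0]
    with j hj hj0
  have : (0 : ℝ) < j := by exact_mod_cast hj0
  rw [Real.log_mul this.ne' hc.ne']
  rw [div_le_iff₀ (by linarith)] at hj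
  linarith

/-- The ratio of consecutive levels tends to `√ρ`; the weaker rate `√√ρ` needs only `log (j + 1) ≤
√ρ * log j`, which follows from `j + 1 ≤ 2j`. It makes the truncation levels geometrically growing.
-/
theorem eventually_sqrt_div_log_growth {ρ : ℝ} (hρ : 1 < ρ) :
    ∀ᶠ j : ℕ in atTop, √√ρ * (√(ρ ^ j) / √(Real.log j)) ≤
      √(ρ ^ (j + 1)) / √(Real.log ((j + 1 : ℕ) : ℝ)) := by
  have hlog : Tendsto (fun j : ℕ => Real.log j) atTop atTop :=
    Real.tendsto_log_atTop.comp tendsto_natCast_atTop_atTop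
  have hs1 : 1 < √ρ := by rwa [Real.lt_sqrt zero_le_one, one_pow]
  filter_upwards [hlog.eventually_ge_atTop (Real.log 2 / (√ρ - 1)), eventually_gt_atTop 1]
    with j hj hj1
  have hj0 : (1 : ℝ) < j := by exact_mod_cast hj1
  have hL : 0 < Real.log j := Real.log_pos hj0
  have hL' : 0 < Real.log ((j + 1 : ℕ) : ℝ) := Real.log_pos (by push_cast; linarith)
  rw [div_le_iff₀ (by linarith)] at hj
  have hle : Real.log ((j + 1 : ℕ) : ℝ) ≤ √ρ * Real.log j := by
    calc Real.log ((j + 1 : ℕ) : ℝ) ≤ Real.log (2 * j) :=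
          Real.log_le_log (by positivity) (by push_cast; linarith)
      _ = Real.log 2 + Real.log j := Real.log_mul (by norm_num) (by positivity)
      _ ≤ _ := by linarith
  have hρ0 : 0 < ρ := by linarith
  rw [← Real.sqrt_div' _ hL.le, ← Real.sqrt_div' _ hL'.le, ← Real.sqrt_mul (Real.sqrt_nonneg ρ)]
  refine Real.sqrt_le_sqrt ?_
  rw [← mul_div_assoc, div_le_div_iff₀ hL hL']
  calc √ρ * ρ ^ j * Real.log ((j + 1 : ℕ) : ℝ) ≤ √ρ * ρ ^ j * (√ρ * Real.log j) := by gcongr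
    _ = √ρ ^ 2 * ρ ^ j * Real.log j := by ring
    _ = ρ ^ (j + 1) * Real.log j := by rw [Real.sq_sqrt hρ0.le]; ring

/-- Comparison of the iterated-logarithm boundary inside a geometric block with its value at the
right endpoint. -/
theorem sqrt_block_le {s : ℝ} (hs : 1 < s) {j k : ℕ} (hj : 1 ≤ j)
    (hlog : Real.log ((j + 1 : ℕ) : ℝ) ≤ s * Real.log (((j + 1 : ℕ) : ℝ) * (Real.log s / 2)))
    (hjk : s ^ j ≤ k) :
    0 < √(2 * (k : ℝ) * Real.log (Real.log k)) ∧
      √2 * √(s ^ (j + 1)) * √(Real.log ((j + 1 : ℕ) : ℝ)) ≤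
        s * √(2 * (k : ℝ) * Real.log (Real.log k)) := by
  have hs0 : 0 < s := by linarith
  have hls : 0 < Real.log s := Real.log_pos hs
  have hj1 : (1 : ℝ) ≤ j := by exact_mod_cast hj
  have hL : 0 < Real.log ((j + 1 : ℕ) : ℝ) := Real.log_pos (by push_cast; linarith)
  have hk0 : (0 : ℝ) < k := lt_of_lt_of_le (by positivity) hjk
  -- The half in `log s / 2` pays for replacing `j` by `j + 1 ≤ 2j`.
  have hlk : ((j + 1 : ℕ) : ℝ) * (Real.log s / 2) ≤ Real.log k := by
    calc ((j + 1 : ℕ) : ℝ) * (Real.log s / 2) ≤ j * Real.log s := by push_cast; nlinarith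
      _ = Real.log (s ^ j) := (Real.log_pow _ _).symm
      _ ≤ Real.log k := Real.log_le_log (by positivity) hjk
  have hll : Real.log ((j + 1 : ℕ) : ℝ) ≤ s * Real.log (Real.log k) :=
    hlog.trans (mul_le_mul_of_nonneg_left (Real.log_le_log (by positivity) hlk) hs0.le)
  have hll0 : 0 < Real.log (Real.log k) := pos_of_mul_pos_right (hL.trans_le hll) hs0.le
  refine ⟨by positivity, ?_⟩
  rw [← Real.sqrt_mul (by norm_num), ← Real.sqrt_mul (by positivity)]
  nth_rewrite 2 [← Real.sqrt_sq hs0.le]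
  rw [← Real.sqrt_mul (by positivity)]
  refine Real.sqrt_le_sqrt ?_
  calc 2 * s ^ (j + 1) * Real.log ((j + 1 : ℕ) : ℝ)
      ≤ 2 * (s * k) * (s * Real.log (Real.log k)) := by
        rw [pow_succ']
        gcongr
    _ = _ := by ring

/-- Distribution-uniform upper half of the law of the iterated logarithm. -/
theorem exists_measure_tail_iterated_log_le (hX : ∀ i, Measurable (X i)) {𝒬 : Set (Measure Ω)}
    (hQ : 𝒬 ⊆ iidCenteredMeasures X)
    (h : Tendsto (fun x : ℝ => ⨆ P ∈ 𝒬, truncatedMoment X 2 P x) atTop (𝓝 0)) {σ : ℝ} (hσ : 0 < σ)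
    (hvar : ∀ P ∈ 𝒬, evariance (X 0) P ≤ ENNReal.ofReal (σ ^ 2)) {ε : ℝ} (hε : 0 < ε)
    {δ : ℝ≥0∞} (hδ : 0 < δ) :
    ∃ m : ℕ, ∀ P ∈ 𝒬,
      P {ω | ∃ k, m ≤ k ∧
        1 + ε ≤ |partialSum X k ω / σ| / √(2 * (k : ℝ) * Real.log (Real.log (k : ℝ)))} ≤ δ := by
  have h0 := hX 0
  -- Half of `ε` goes to `3e` in the block inequality; the rest is the block ratio `s > 1`, with `(1
  -- + 3e) * s = 1 + ε` exactly.
  obtain ⟨e, he⟩ : ∃ e : ℝ, e = ε / 6 := ⟨_, rfl⟩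
  have he0 : 0 < e := by rw [he]; positivity
  obtain ⟨s, hsdef⟩ : ∃ s : ℝ, s = (1 + ε) / (1 + 3 * e) := ⟨_, rfl⟩
  have hs : 1 < s := by
    rw [hsdef, one_lt_div (by positivity), he]
    linarith
  have hs0 : 0 < s := by linarith
  have hes : (1 + 3 * e) * s = 1 + ε := by
    rw [hsdef]
    field_simp
  obtain ⟨η, hη⟩ : ∃ η : ℝ, η = σ * Real.log (1 + e) / (2 * √2) := ⟨_, rfl⟩
  have hlog : 0 < Real.log (1 + e) := Real.log_pos (by linarith)
  have hη0 : 0 < η := by rw [hη]; positivity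
  obtain ⟨κ, hκdef⟩ : ∃ κ : ℝ, κ = √√s := ⟨_, rfl⟩
  have hκ : 1 < κ := by
    rw [hκdef, Real.lt_sqrt zero_le_one, one_pow, Real.lt_sqrt zero_le_one, one_pow]
    exact hs
  have hκ' : 0 < κ - 1 := by linarith
  obtain ⟨b, hb⟩ : ∃ b : ℕ → ℝ, b = fun j : ℕ => η * (√(s ^ j) / √(Real.log j)) := ⟨_, rfl⟩
  obtain ⟨J₀, hJ₀⟩ := ((eventually_log_le_mul_log_mul hs (c := Real.log s / 2)
    (half_pos (Real.log_pos hs))).and ((eventually_sqrt_div_log_growth hs).and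
      (eventually_ge_atTop 2))).exists_forall_of_atTop
  have hlogpos : ∀ j, J₀ ≤ j → 0 < Real.log j := by
    intro j hj
    have := (hJ₀ j hj).2.2
    exact Real.log_pos (by exact_mod_cast this)
  have hbpos : ∀ j, J₀ ≤ j → 0 < b j := by
    intro j hj
    have := hlogpos j hj
    rw [hb]
    positivity
  have hbgrow : ∀ j, J₀ ≤ j → κ * b j ≤ b (j + 1) := by
    intro j hj
    have := mul_le_mul_of_nonneg_left (hJ₀ j hj).2.1 hη0.le
    rw [hb, hκdef]
    refine le_of_eq_of_le ?_ this
    ring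
  have hbtop : Tendsto b atTop atTop := by
    have := tendsto_atTop_of_geom_le (v := fun i => b (i + J₀)) (c := κ) (hbpos _ (by omega)) hκ
      fun i => by
        have := hbgrow (i + J₀) (by omega)
        rwa [show i + 1 + J₀ = i + J₀ + 1 by ring]
    exact (tendsto_add_atTop_iff_nat J₀).1 this
  set D : ℝ := e * σ * √2 * η with hD
  have hD0 : 0 < D := by positivity
  set A : ℝ := 1 / D * (κ / (κ - 1)) with hA
  have hA0 : 0 < A := by positivity
  have hδ2 : 0 < δ / 2 := ENNReal.half_pos hδ.ne'
  have hη' : 0 < δ / 2 / ENNReal.ofReal A := ENNReal.div_pos hδ2.ne' ENNReal.ofReal_ne_top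
  obtain ⟨K, hK1, hK2⟩ := ((eventually_truncatedMoment_le h hη').and
    (eventually_truncatedMoment_le h (ENNReal.ofReal_pos.2 hD0))).exists
  -- With `w² = log j` the Bernstein term `exp (-(1 + e) w²)` is `j^{-(1+e)}`, whose tail sums
  -- vanish.
  have hexpsum : Tendsto (fun J => ∑' j : ℕ, 2 * ENNReal.ofReal (1 / ((j + J : ℕ) : ℝ) ^ (1 + e)))
      atTop (𝓝 0) := by
    refine ENNReal.tendsto_sum_nat_add (fun j : ℕ => 2 * ENNReal.ofReal (1 / (j : ℝ) ^ (1 + e))) ?_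
    rw [ENNReal.tsum_mul_left]
    exact ENNReal.mul_ne_top (by norm_num)
      (Real.summable_one_div_nat_rpow.2 (by linarith)).tsum_ofReal_ne_top
  have hbK : ∀ᶠ j in atTop, K ≤ b j ^ 2 :=
    ((tendsto_pow_atTop two_ne_zero).comp hbtop).eventually_ge_atTop K
  obtain ⟨J, hJ1, hJ2, hJ3⟩ := ((hexpsum.eventually (gt_mem_nhds hδ2)).and
    ((eventually_forall_ge_atTop.2 hbK).and (eventually_ge_atTop J₀))).exists
  refine ⟨⌈s ^ J⌉₊, fun P hP => ?_⟩
  have hset : {ω | ∃ k, ⌈s ^ J⌉₊ ≤ k ∧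
        1 + ε ≤ |partialSum X k ω / σ| / √(2 * (k : ℝ) * Real.log (Real.log (k : ℝ)))} ⊆
      ⋃ j : ℕ, {ω | ∃ k : ℕ, (k : ℝ) ≤ √(s ^ (j + J)) ^ 2 ∧
        (1 + 3 * e) * (σ * (√2 * √(s ^ (j + J)) * √(Real.log (j + J : ℕ)))) ≤
          |partialSum X k ω|} := by
    rintro ω ⟨k, hk, hkε⟩
    have hk' : s ^ J ≤ k := Nat.ceil_le.1 hk
    obtain ⟨j, hj1, hj2⟩ := exists_nat_pow_near ((one_le_pow₀ hs.le).trans hk') hs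
    have hJj : J < j + 1 := (pow_lt_pow_iff_right₀ hs).1 (hk'.trans_lt hj2)
    have hj2' : 2 ≤ j + 1 := (hJ₀ (j + 1) (by omega)).2.2
    obtain ⟨hpos, hle⟩ := sqrt_block_le hs (by omega) (hJ₀ (j + 1) (by omega)).1 hj1
    refine Set.mem_iUnion.2 ⟨j + 1 - J, k, ?_, ?_⟩
    · rw [Nat.sub_add_cancel hJj.le, Real.sq_sqrt (by positivity)]
      exact hj2.le
    · rw [Nat.sub_add_cancel hJj.le]
      rw [abs_div, abs_of_pos hσ, le_div_iff₀ hpos, le_div_iff₀ hσ] at hkε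
      refine le_trans ?_ hkε
      calc _ ≤ (1 + 3 * e) * (σ * (s * √(2 * (k : ℝ) * Real.log (Real.log k)))) := by gcongr
        _ = (1 + 3 * e) * s * √(2 * (k : ℝ) * Real.log (Real.log k)) * σ := by ring
        _ = _ := by rw [hes]
  refine (measure_mono hset).trans ((measure_iUnion_le _).trans ?_)
  calc _ ≤ ∑' j : ℕ, (2 * ENNReal.ofReal (1 / ((j + J : ℕ) : ℝ) ^ (1 + e)) +
          ∫⁻ ω, ENNReal.ofReal (1 / D *
            (if b (j + J) ≤ |X 0 ω| then b (j + J) else 0) * |X 0 ω|) ∂P) := by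
        refine ENNReal.tsum_le_tsum fun j => ?_
        have hlj := hlogpos (j + J) (by omega)
        have hblk := measure_exists_partialSum_ge_block_le hX (hQ hP) hσ he0
          (u := √(s ^ (j + J))) (w := √(Real.log (j + J : ℕ))) (by positivity) (by positivity)
          (hvar P hP) hη ?_
        · have hexp : Real.exp (-((1 + e) * √(Real.log (j + J : ℕ)) ^ 2)) =
              1 / ((j + J : ℕ) : ℝ) ^ (1 + e) := by
            have hjJ : (0 : ℝ) < (j + J : ℕ) := by
              have := (hJ₀ (j + J) (by omega)).2.2
              exact_mod_cast (by omega : 0 < j + J)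
            rw [Real.sq_sqrt hlj.le, Real.exp_neg, one_div, Real.rpow_def_of_pos hjJ, mul_comm]
          rw [hexp] at hblk
          rw [hb]
          exact hblk
        · refine (truncatedMoment_antitone 2 P ?_).trans (hK2 P hP)
          have := hJ2 (j + J) (by omega)
          rwa [hb] at this
    _ ≤ δ / 2 + ∫⁻ ω, ENNReal.ofReal
          (A * (if K ≤ |X 0 ω| ^ (2 : ℝ) then |X 0 ω| ^ (2 : ℝ) else 0)) ∂P := by
        rw [ENNReal.tsum_add]
        refine add_le_add hJ1.le (tsum_lintegral_ofReal_le (fun j => ?_) (fun j ω => ?_)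
          fun N ω => ?_)
        · refine Measurable.mul (Measurable.const_mul (Measurable.ite ?_ ?_ ?_) _) (by fun_prop)
          · exact measurableSet_le measurable_const (by fun_prop)
          · fun_prop
          · fun_prop
        · have := hbpos (j + J) (by omega)
          refine mul_nonneg (mul_nonneg (by positivity) ?_) (abs_nonneg _)
          split_ifs <;> positivity
        -- For fixed `x`, the levels `b_j ≤ |x|` sum to at most `κ / (κ - 1) * |x|`, which gives
        -- `x²`. If `x² < K` no level qualifies, because `K ≤ b_j²` from `J` on, so no remainder
        -- appears.
        · rw [← Finset.sum_mul, ← Finset.mul_sum, Real.rpow_two]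
          split_ifs with hKx
          · have hsum := sum_range_ite_le_of_growth (b := fun j => b (j + J)) hκ
              (fun j => (hbpos (j + J) (by omega)).le)
              (fun j => by
                have := hbgrow (j + J) (by omega)
                rwa [show j + 1 + J = j + J + 1 by ring])
              (abs_nonneg (X 0 ω)) N
            calc _ ≤ 1 / D * (κ / (κ - 1) * |X 0 ω|) * |X 0 ω| := by gcongr
              _ = _ := by rw [hA]; ring
          · rw [Finset.sum_eq_zero]
            · simp
            · intro j _
              refine if_neg fun hbx => hKx ((hJ2 (j + J) (by omega)).trans ?_)
              exact pow_le_pow_left₀ (hbpos (j + J) (by omega)).le hbx 2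
    _ = δ / 2 + ENNReal.ofReal A * truncatedMoment X 2 P K := by
        rw [truncatedMoment_eq_lintegral hX, ← lintegral_const_mul' _ _ ENNReal.ofReal_ne_top]
        simp only [ENNReal.ofReal_mul hA0.le]
    _ ≤ δ / 2 + δ / 2 := by
        gcongr
        calc _ ≤ ENNReal.ofReal A * (δ / 2 / ENNReal.ofReal A) := by
              gcongr
              exact hK1 P hP
          _ = δ / 2 := ENNReal.mul_div_cancel (by simp [hA0]) ENNReal.ofReal_ne_top
    _ = δ := ENNReal.add_halves δ

end IteratedLogarithm

/-! ### From the uniform tail bounds to inverse capital. -/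

theorem measurable_partialSum {Ω : Type*} {mΩ : MeasurableSpace Ω} {X : ℕ → Ω → ℝ}
    {ℱ : Filtration ℕ mΩ} (hX : ∀ n, Measurable[ℱ (n + 1)] (X n)) (k : ℕ) :
    Measurable[ℱ k] (partialSum X k) :=
  Finset.measurable_fun_sum _ fun i hi =>
    (hX i).mono (ℱ.mono (Finset.mem_range.1 hi)) le_rfl

theorem exists_frequently_of_mem_divEvent {Ω : Type*} {X : ℕ → Ω → ℝ} {q : ℝ} {ω : Ω}
    (hω : ω ∈ divEvent X q) :
    ∃ j : ℕ, ∀ m, ∃ k, m ≤ k ∧ 1 / ((j : ℝ) + 1) ≤ |partialSum X k ω / (k : ℝ) ^ (1 / q)| := by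
  by_contra! hcon
  refine hω (Metric.tendsto_atTop.2 fun ε hε => ?_)
  obtain ⟨j, hj⟩ := exists_nat_one_div_lt hε
  obtain ⟨m, hm⟩ := hcon j
  refine ⟨m, fun k hk => ?_⟩
  rw [Real.dist_eq, sub_zero]
  exact (hm k hk).trans hj

theorem exists_frequently_of_mem_flucEvent {Ω : Type*} {X : ℕ → Ω → ℝ} {σ : ℝ} {ω : Ω}
    (hω : ω ∈ flucEvent X σ) :
    ∃ j : ℕ, ∀ m, ∃ k, m ≤ k ∧ 1 + 1 / ((j : ℝ) + 1) ≤
      |partialSum X k ω / σ| / √(2 * (k : ℝ) * Real.log (Real.log (k : ℝ))) := by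
  simp only [flucEvent, Set.mem_iUnion, Set.mem_iInter, Set.mem_ofPred_eq] at hω
  obtain ⟨ε, hε, hω⟩ := hω
  obtain ⟨j, hj⟩ := exists_nat_one_div_lt hε
  refine ⟨j, fun m => ?_⟩
  -- The shift to `m + 1` satisfies the side condition `1 ≤ m` in `flucEvent`.
  obtain ⟨k, hk, hkε⟩ := hω (m + 1) (by omega)
  exact ⟨k, by omega, by linarith⟩

theorem mainTheorem11 {Ω : Type*} {mΩ : MeasurableSpace Ω} (X : ℕ → Ω → ℝ)
    (ℱ : Filtration ℕ mΩ) (hX : ∀ n, Measurable[ℱ (n + 1)] (X n))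
    (𝒬 : Set (Measure Ω)) (hQ : 𝒬 ⊆ iidCenteredMeasures X) :
    (∀ q : ℝ, 1 ≤ q → q < 2 →
      Tendsto (fun x : ℝ => ⨆ P ∈ 𝒬, truncatedMoment X q P x) atTop (𝓝 0) →
      inverseCapital ℱ 𝒬 (divEvent X q) = 0) ∧
    (Tendsto (fun x : ℝ => ⨆ P ∈ 𝒬, truncatedMoment X 2 P x) atTop (𝓝 0) →
      (∃ σ : ℝ, 0 < σ ∧ ∀ P ∈ 𝒬, evariance (X 0) P ≤ ENNReal.ofReal (σ ^ 2)) ∧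
      ∀ σ : ℝ, 0 < σ → (∀ P ∈ 𝒬, evariance (X 0) P ≤ ENNReal.ofReal (σ ^ 2)) →
        inverseCapital ℱ 𝒬 (flucEvent X σ) = 0) := by
  have hXm : ∀ i, Measurable (X i) := fun i => (hX i).mono (ℱ.le _) le_rfl
  refine ⟨fun q hq hq2 h => ?_, fun h => ⟨?_, fun σ hσ hvar => ?_⟩⟩
  · refine inverseCapital_eq_zero ℱ 𝒬 _
      (fun j k => {ω | 1 / ((j : ℝ) + 1) ≤ |partialSum X k ω / (k : ℝ) ^ (1 / q)|})
      (fun j k => ?_) (fun ω hω => exists_frequently_of_mem_divEvent hω) fun j δ hδ =>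
        exists_measure_tail_partialSum_rpow_le hXm hQ hq hq2 h (by positivity) hδ
    have hs : MeasurableSet {x : ℝ | 1 / ((j : ℝ) + 1) ≤ |x / (k : ℝ) ^ (1 / q)|} :=
      measurableSet_le measurable_const (by fun_prop)
    exact measurable_partialSum hX k hs
  · obtain ⟨K, hK, hK0⟩ :=
      ((eventually_truncatedMoment_le h zero_lt_one).and (eventually_gt_atTop 0)).exists
    refine ⟨√(K + 1), by positivity, fun P hP => ?_⟩
    rw [Real.sq_sqrt (by positivity)]
    exact evariance_le_of_truncatedMoment_le hXm (hQ hP) hK0 (hK P hP)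
  · refine inverseCapital_eq_zero ℱ 𝒬 _
      (fun j k => {ω | 1 + 1 / ((j : ℝ) + 1) ≤
        |partialSum X k ω / σ| / √(2 * (k : ℝ) * Real.log (Real.log (k : ℝ)))})
      (fun j k => ?_) (fun ω hω => exists_frequently_of_mem_flucEvent hω) fun j δ hδ =>
        exists_measure_tail_iterated_log_le hXm hQ h hσ hvar (by positivity) hδ
    have hs : MeasurableSet {x : ℝ | 1 + 1 / ((j : ℝ) + 1) ≤
        |x / σ| / √(2 * (k : ℝ) * Real.log (Real.log (k : ℝ)))} :=
      measurableSet_le measurable_const (by fun_prop)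
    exact measurable_partialSum hX k hs
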